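/- Let $\mathbb K$ be a field of characteristic zero. "Operad" means symmetric operad (arities $n\ge 0$) in $\mathbb Z$-graded $\mathbb K$-vector spaces, with homological degrees and right actions $x\mapsto x^\sigma$ of the symmetric groups; a dg operad is an operad with an equivariant differential $d$ of degree $-1$, $d^2=0$, that is a derivation of the partial compositions $\circ_i$. Let $[\kappa]$ be the free operad on one operation $\kappa$ of arity $0$ and degree $-1$, and let $\vee$ denote the coproduct of operads. Let $\operatorname{Curv}^\Sigma$ be the category whose objects are the quadruples $(\mathrm Q,d,\kappa,\mathrm Q_0)$, where $(\mathrm Q,d)$ is a dg operad, $\mathrm Q_0\subset\mathrm Q$ is a suboperad of the underlying graded operad (not necessarily stable under $d$), and $\kappa\in\mathrm Q\setminus\mathrm Q_0$ has arity $0$ and degree $-1$, such that 1. the natural morphism $\mathrm Q_0\vee[\kappa]\to\mathrm Q$ is an isomorphism; 2. with respect to the resulting weight grading of $\mathrm Q$ by the number of occurrences of $\kappa$, one has $d=d_0+d_1$, where $d_0$ preserves the weight and $d_1$ raises it by one; 3. $d_1\kappa=0$. Its morphisms are the morphisms of dg operads that send $\kappa$ to $\kappa$ and the distinguished suboperad into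 the distinguished suboperad. Let $\mathrm{cL}_\infty$ be the free operad on generators $\ell_n$, $n\ge 0$, of arity $n$ and degree $-1$, with $\ell_n^\sigma=\ell_n$ for all $\sigma\in\mathbb S_n$. **Theorem.** There is a differential $d$ on $\mathrm{cL}_\infty$, making it a dg operad, with $$d(\ell_n)=-\sum_{\substack{p+q=n\\ p,q\ge 0}}\ \sum_{\sigma}(\ell_{p+1}\circ_1\ell_q)^\sigma\qquad(n\ge 0),$$ where $\sigma$ runs over the permutations in $\mathbb S_n$ whose inverse is increasing on $\{1,\dots,q\}$ and on $\{q+1,\dots,n\}$. With this $d$, the quadruple $(\mathrm{cL}_\infty,d,\ell_0,\langle\ell_i\rangle_{i>0})$, where $\langle\ell_i\rangle_{i>0}$ is the suboperad generated by the $\ell_i$ with $i>0$, is an object of $\operatorname{Curv}^\Sigma$, and it is an initial object of $\operatorname{Curv}^\Sigma$. -/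

import Mathlib

open CategoryTheory

universe u

/-- The sign `(-1)^a` as a scalar. -/
def koszulSign (K : Type u) [Field K] (a : ℤ) : K := ((a.negOnePow : ℤ) : K)

/-- Insert `n` inputs in place of input `i` (inputs are numbered from `0`): the new number of an
old input `k ≠ i`. The inserted inputs are numbered `i, …, i + n - 1`. -/
def outerSlot (i n k : ℕ) : ℕ := if k < i then k else k + n - 1

/-- `τ` is the permutation of the `r = m + n - 1` inputs of a partial composite induced by a
permutation `σ` of the inputs of the outer operation and a permutation `ρ` of the inputs of the
inner operation: it carries the block inserted at `i` to the block inserted at `σ i`, acting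
inside as `ρ`, and it moves the other inputs as `σ` does. -/
def IsBlockPerm {m n r : ℕ} (i : Fin m) (σ : Equiv.Perm (Fin m)) (ρ : Equiv.Perm (Fin n))
    (τ : Equiv.Perm (Fin r)) : Prop :=
  (∀ (j : Fin n) (s : Fin r), (s : ℕ) = i + j → (τ s : ℕ) = σ i + ρ j) ∧
  (∀ (k : Fin m) (s : Fin r), k ≠ i → (s : ℕ) = outerSlot i n k →
    (τ s : ℕ) = outerSlot (σ i) n (σ k))

/-- A symmetric operad in `ℤ`-graded `K`-vector spaces, in terms of partial compositions.
`obj n k` is the space of operations of arity `n` and (homological) degree `k`; `act σ x` is the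
right action `x ^ σ`, for which input `s` of `x ^ σ` is input `σ s` of `x`; and
`comp i _ _ _ x y` is the partial composite `x ∘ y` at input number `i` (counted from `0`) of `x`.
The arity `r = m + n - 1` and the degree `c = a + b` of a composite are arguments tied to those of
the factors by equations, so that no transport along equalities is needed. -/
structure GrOperad (K : Type u) [Field K] where
  obj : ℕ → ℤ → Type u
  [addCommGroup : ∀ n k, AddCommGroup (obj n k)]
  [module : ∀ n k, Module K (obj n k)]
  one : obj 1 0
  act : ∀ {n : ℕ} {k : ℤ}, Equiv.Perm (Fin n) → obj n k →ₗ[K] obj n k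
  comp : ∀ {m n r : ℕ} {a b c : ℤ} (i : ℕ), i < m → m + n = r + 1 → a + b = c →
    (obj m a →ₗ[K] obj n b →ₗ[K] obj r c)
  act_one : ∀ {n : ℕ} {k : ℤ} (x : obj n k), act 1 x = x
  act_mul : ∀ {n : ℕ} {k : ℤ} (σ τ : Equiv.Perm (Fin n)) (x : obj n k),
    act (σ * τ) x = act τ (act σ x)
  one_comp : ∀ {n : ℕ} {a : ℤ} (hi : 0 < 1) (hr : 1 + n = n + 1) (hd : 0 + a = a) (x : obj n a),
    comp 0 hi hr hd one x = x
  comp_one : ∀ {m : ℕ} {a : ℤ} (i : ℕ) (hi : i < m) (hr : m + 1 = m + 1) (hd : a + 0 = a)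
    (x : obj m a), comp i hi hr hd x one = x
  /-- Sequential composition. -/
  comp_assoc : ∀ {m n p r s t : ℕ} {a b c e f g : ℤ} (i j : ℕ) (hi : i < m) (hj : j < n)
    (hr : m + n = r + 1) (hs : n + p = s + 1) (hij : i + j < r)
    (ht : r + p = t + 1) (ht' : m + s = t + 1)
    (he : a + b = e) (hg : b + c = g) (hf : e + c = f) (hf' : a + g = f)
    (x : obj m a) (y : obj n b) (z : obj p c),
    comp (i + j) hij ht hf (comp i hi hr he x y) z = comp i hi ht' hf' x (comp j hj hs hg y z)
  /-- Parallel composition, with its Koszul sign. -/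
  comp_comm : ∀ {m n p r s t : ℕ} {a b c e f g : ℤ} (i k l : ℕ) (_hik : i < k)
    (hi : i < m) (hk : k < m) (_hl : l + 1 = k + n)
    (hr : m + n = r + 1) (hs : m + p = s + 1) (hlr : l < r) (his : i < s)
    (ht : r + p = t + 1) (ht' : s + n = t + 1)
    (he : a + b = e) (hg : a + c = g) (hf : e + c = f) (hf' : g + b = f)
    (x : obj m a) (y : obj n b) (z : obj p c),
    comp l hlr ht hf (comp i hi hr he x y) z =
      koszulSign K (b * c) • comp i his ht' hf' (comp k hk hs hg x z) y
  /-- Equivariance of the partial compositions. -/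
  comp_act : ∀ {m n r : ℕ} {a b c : ℤ} (i : Fin m) (hr : m + n = r + 1) (hd : a + b = c)
    (σ : Equiv.Perm (Fin m)) (ρ : Equiv.Perm (Fin n)) (τ : Equiv.Perm (Fin r)),
    IsBlockPerm i σ ρ τ → ∀ (x : obj m a) (y : obj n b),
    comp i i.isLt hr hd (act σ x) (act ρ y) = act τ (comp (σ i) (σ i).isLt hr hd x y)

attribute [instance] GrOperad.addCommGroup GrOperad.module

/-- Morphisms of graded symmetric operads. -/
@[ext]
structure GrOperad.Hom {K : Type u} [Field K] (P Q : GrOperad K) where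
  map : ∀ (n : ℕ) (k : ℤ), P.obj n k →ₗ[K] Q.obj n k
  map_one : map 1 0 P.one = Q.one
  map_act : ∀ {n : ℕ} {k : ℤ} (σ : Equiv.Perm (Fin n)) (x : P.obj n k),
    map n k (P.act σ x) = Q.act σ (map n k x)
  map_comp : ∀ {m n r : ℕ} {a b c : ℤ} (i : ℕ) (hi : i < m) (hr : m + n = r + 1)
    (hd : a + b = c) (x : P.obj m a) (y : P.obj n b),
    map r c (P.comp i hi hr hd x y) = Q.comp i hi hr hd (map m a x) (map n b y)

/-- A suboperad of a graded symmetric operad. -/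
@[ext]
structure Suboperad {K : Type u} [Field K] (Q : GrOperad K) where
  carrier : ∀ (n : ℕ) (k : ℤ), Submodule K (Q.obj n k)
  one_mem : Q.one ∈ carrier 1 0
  act_mem : ∀ {n : ℕ} {k : ℤ} (σ : Equiv.Perm (Fin n)) {x : Q.obj n k},
    x ∈ carrier n k → Q.act σ x ∈ carrier n k
  comp_mem : ∀ {m n r : ℕ} {a b c : ℤ} (i : ℕ) (hi : i < m) (hr : m + n = r + 1)
    (hd : a + b = c) {x : Q.obj m a} {y : Q.obj n b},
    x ∈ carrier m a → y ∈ carrier n b → Q.comp i hi hr hd x y ∈ carrier r c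

/-- A suboperad is an operad with the restricted operations. -/
def Suboperad.toGrOperad {K : Type u} [Field K] {Q : GrOperad K} (S : Suboperad Q) :
    GrOperad K where
  obj n k := S.carrier n k
  one := ⟨Q.one, S.one_mem⟩
  act σ := (Q.act σ).restrict fun _ hx => S.act_mem σ hx
  comp i hi hr hd := LinearMap.mk₂ K
    (fun x y => ⟨Q.comp i hi hr hd x.1 y.1, S.comp_mem i hi hr hd x.2 y.2⟩)
    (fun _ _ _ => Subtype.ext (by simp)) (fun _ _ _ => Subtype.ext (by simp))
    (fun _ _ _ => Subtype.ext (by simp)) (fun _ _ _ => Subtype.ext (by simp))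
  act_one x := Subtype.ext (Q.act_one x.1)
  act_mul σ τ x := Subtype.ext (Q.act_mul σ τ x.1)
  one_comp hi hr hd x := Subtype.ext (Q.one_comp hi hr hd x.1)
  comp_one i hi hr hd x := Subtype.ext (Q.comp_one i hi hr hd x.1)
  comp_assoc i j hi hj hr hs hij ht ht' he hg hf hf' x y z :=
    Subtype.ext (Q.comp_assoc i j hi hj hr hs hij ht ht' he hg hf hf' x.1 y.1 z.1)
  comp_comm i k l hik hi hk hl hr hs hlr his ht ht' he hg hf hf' x y z :=
    Subtype.ext (Q.comp_comm i k l hik hi hk hl hr hs hlr his ht ht' he hg hf hf' x.1 y.1 z.1)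
  comp_act i hr hd σ ρ τ h x y := Subtype.ext (Q.comp_act i hr hd σ ρ τ h x.1 y.1)

/-- The suboperad generated by a family of sets of operations: the smallest one containing it. -/
def Suboperad.closure {K : Type u} [Field K] {Q : GrOperad K}
    (s : ∀ (n : ℕ) (k : ℤ), Set (Q.obj n k)) : Suboperad Q where
  carrier n k := ⨅ (S : Suboperad Q) (_ : ∀ n k, s n k ⊆ S.carrier n k), S.carrier n k
  one_mem := by
    simp only [Submodule.mem_iInf]
    exact fun S _ => S.one_mem
  act_mem σ x hx := by
    simp only [Submodule.mem_iInf] at hx ⊢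
    exact fun S hS => S.act_mem σ (hx S hS)
  comp_mem i hi hr hd x y hx hy := by
    simp only [Submodule.mem_iInf] at hx hy ⊢
    exact fun S hS => S.comp_mem i hi hr hd (hx S hS) (hy S hS)

/-- A differential on a graded symmetric operad, making it a symmetric dg operad: an equivariant
derivation of degree `-1` and square zero. -/
structure DGStructure {K : Type u} [Field K] (Q : GrOperad K) where
  d : ∀ {n : ℕ} {k : ℤ}, Q.obj n k →ₗ[K] Q.obj n (k - 1)
  d_act : ∀ {n : ℕ} {k : ℤ} (σ : Equiv.Perm (Fin n)) (x : Q.obj n k),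
    d (Q.act σ x) = Q.act σ (d x)
  d_comp : ∀ {m n r : ℕ} {a b c : ℤ} (i : ℕ) (hi : i < m) (hr : m + n = r + 1)
    (hd : a + b = c) (x : Q.obj m a) (y : Q.obj n b),
    d (Q.comp i hi hr hd x y) =
      Q.comp i hi hr (show (a - 1) + b = c - 1 by omega) (d x) y +
        koszulSign K a • Q.comp i hi hr (show a + (b - 1) = c - 1 by omega) x (d y)
  d_d : ∀ {n : ℕ} {k : ℤ} (x : Q.obj n k), d (d x) = 0

/-- `Q` is the coproduct of its suboperad `S` and the free operad `[κ]` on the single operation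
`κ` of arity `0`, that is, the natural morphism `S ∨ [κ] ⟶ Q` is an isomorphism. A morphism
from `[κ]` to `P` is the choice of an operation of `P` of arity `0` and of the degree of `κ`. -/
def IsFreelyExtendedBy {K : Type u} [Field K] (Q : GrOperad K) (S : Suboperad Q)
    (κ : Q.obj 0 (-1)) : Prop :=
  ∀ (P : GrOperad K) (f : S.toGrOperad.Hom P) (p : P.obj 0 (-1)),
    ∃! g : Q.Hom P,
      (∀ (n : ℕ) (k : ℤ) (x : S.carrier n k), g.map n k x = f.map n k x) ∧ g.map 0 (-1) κ = p

/-- `HasWeight S κ w x`: the operation `x` is a linear combination of expressions in `κ` and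
operations of `S` in each of which `κ` appears `w` times. -/
inductive HasWeight {K : Type u} [Field K] {Q : GrOperad K} (S : Suboperad Q)
    (κ : Q.obj 0 (-1)) : ℕ → ∀ {n : ℕ} {k : ℤ}, Q.obj n k → Prop
  | of_mem {n : ℕ} {k : ℤ} {x : Q.obj n k} : x ∈ S.carrier n k → HasWeight S κ 0 x
  | kappa : HasWeight S κ 1 κ
  | zero (w n : ℕ) (k : ℤ) : HasWeight S κ w (0 : Q.obj n k)
  | add {w n : ℕ} {k : ℤ} {x y : Q.obj n k} :
      HasWeight S κ w x → HasWeight S κ w y → HasWeight S κ w (x + y)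
  | smul {w n : ℕ} {k : ℤ} (t : K) {x : Q.obj n k} :
      HasWeight S κ w x → HasWeight S κ w (t • x)
  | act {w n : ℕ} {k : ℤ} (σ : Equiv.Perm (Fin n)) {x : Q.obj n k} :
      HasWeight S κ w x → HasWeight S κ w (Q.act σ x)
  | comp {v w m n r : ℕ} {a b c : ℤ} (i : ℕ) (hi : i < m) (hr : m + n = r + 1)
      (hd : a + b = c) {x : Q.obj m a} {y : Q.obj n b} :
      HasWeight S κ v x → HasWeight S κ w y → HasWeight S κ (v + w) (Q.comp i hi hr hd x y)

/-- The structure of an object of `Curv^Σ` on a graded symmetric operad `Q`: a differential `d`,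
an operation `κ` of arity `0` and degree `-1`, and a suboperad `base` of the graded operad `Q`
that does not contain `κ`, such that `Q` is freely generated by `κ` over `base`; `d = d₀ + d₁`
where `d₀` preserves the weight (the number of `κ`) and `d₁` raises it by one; and `d₁ κ = 0`. -/
structure CurvStructure {K : Type u} [Field K] (Q : GrOperad K) extends DGStructure Q where
  κ : Q.obj 0 (-1)
  base : Suboperad Q
  κ_notMem : κ ∉ base.carrier 0 (-1)
  free : IsFreelyExtendedBy Q base κ
  mixed : ∃ d₀ d₁ : ∀ {n : ℕ} {k : ℤ}, Q.obj n k →ₗ[K] Q.obj n (k - 1),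
    (∀ {n : ℕ} {k : ℤ} (x : Q.obj n k), d x = d₀ x + d₁ x) ∧
    (∀ {w n : ℕ} {k : ℤ} (x : Q.obj n k), HasWeight base κ w x → HasWeight base κ w (d₀ x)) ∧
    (∀ {w n : ℕ} {k : ℤ} (x : Q.obj n k),
      HasWeight base κ w x → HasWeight base κ (w + 1) (d₁ x)) ∧
    d₁ κ = 0

/-- The objects `(Q, d, κ, Q₀)` of the category `Curv^Σ`. -/
structure CurvSigma (K : Type u) [Field K] where
  operad : GrOperad K
  str : CurvStructure operad

/-- Morphisms of quadruples: morphisms of dg operads that send `κ` to `κ` and the distinguished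
suboperad into the distinguished suboperad. -/
@[ext]
structure CurvSigma.Hom {K : Type u} [Field K] (X Y : CurvSigma K)
    extends GrOperad.Hom X.operad Y.operad where
  map_d : ∀ {n : ℕ} {k : ℤ} (x : X.operad.obj n k),
    map n (k - 1) (X.str.d x) = Y.str.d (map n k x)
  map_κ : map 0 (-1) X.str.κ = Y.str.κ
  map_base : ∀ {n : ℕ} {k : ℤ} {x : X.operad.obj n k},
    x ∈ X.str.base.carrier n k → map n k x ∈ Y.str.base.carrier n k

instance CurvSigma.category (K : Type u) [Field K] : Category (CurvSigma K) where
  Hom := CurvSigma.Hom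
  id X :=
    { map := fun _ _ => LinearMap.id
      map_one := rfl
      map_act := fun _ _ => rfl
      map_comp := fun _ _ _ _ _ _ => rfl
      map_d := fun _ => rfl
      map_κ := rfl
      map_base := fun h => h }
  comp f g :=
    { map := fun n k => (g.map n k).comp (f.map n k)
      map_one := by simp [f.map_one, g.map_one]
      map_act := fun σ x => by simp [f.map_act, g.map_act]
      map_comp := fun i hi hr hd x y => by simp [f.map_comp, g.map_comp]
      map_d := fun x => by simp [f.map_d, g.map_d]
      map_κ := by simp [f.map_κ, g.map_κ]
      map_base := fun h => g.map_base (f.map_base h) }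

/-- Formal operadic expressions in symbols `ℓ 0, ℓ 1, ℓ 2, …`, where `ℓ n` has arity `n` and
degree `-1`. -/
inductive LTerm (K : Type u) [Field K] : ℕ → ℤ → Type u
  | ell (n : ℕ) : LTerm K n (-1)
  | one : LTerm K 1 0
  | zero (n : ℕ) (k : ℤ) : LTerm K n k
  | add {n : ℕ} {k : ℤ} : LTerm K n k → LTerm K n k → LTerm K n k
  | smul {n : ℕ} {k : ℤ} : K → LTerm K n k → LTerm K n k
  | act {n : ℕ} {k : ℤ} : Equiv.Perm (Fin n) → LTerm K n k → LTerm K n k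
  | comp {m n r : ℕ} {a b c : ℤ} (i : ℕ) : i < m → m + n = r + 1 → a + b = c →
      LTerm K m a → LTerm K n b → LTerm K r c

/-- The relations of the free operad: the axioms of vector spaces and of operads, and the
invariance of each `ℓ n` under the symmetric group. -/
inductive LTerm.Rel (K : Type u) [Field K] :
    ∀ {n : ℕ} {k : ℤ}, LTerm K n k → LTerm K n k → Prop
  | add_comm {n : ℕ} {k : ℤ} (x y : LTerm K n k) : Rel K (x.add y) (y.add x)
  | add_assoc {n : ℕ} {k : ℤ} (x y z : LTerm K n k) :
      Rel K ((x.add y).add z) (x.add (y.add z))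
  | zero_add {n : ℕ} {k : ℤ} (x : LTerm K n k) : Rel K ((zero n k).add x) x
  | zero_smul {n : ℕ} {k : ℤ} (x : LTerm K n k) : Rel K (smul 0 x) (zero n k)
  | one_smul {n : ℕ} {k : ℤ} (x : LTerm K n k) : Rel K (smul 1 x) x
  | mul_smul {n : ℕ} {k : ℤ} (s t : K) (x : LTerm K n k) :
      Rel K (smul (s * t) x) (smul s (smul t x))
  | smul_add {n : ℕ} {k : ℤ} (t : K) (x y : LTerm K n k) :
      Rel K (smul t (x.add y)) ((smul t x).add (smul t y))
  | add_smul {n : ℕ} {k : ℤ} (s t : K) (x : LTerm K n k) :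
      Rel K (smul (s + t) x) ((smul s x).add (smul t x))
  | add_congr_left {n : ℕ} {k : ℤ} {x x' : LTerm K n k} (y : LTerm K n k) :
      Rel K x x' → Rel K (x.add y) (x'.add y)
  | add_congr_right {n : ℕ} {k : ℤ} (x : LTerm K n k) {y y' : LTerm K n k} :
      Rel K y y' → Rel K (x.add y) (x.add y')
  | smul_congr {n : ℕ} {k : ℤ} (t : K) {x x' : LTerm K n k} :
      Rel K x x' → Rel K (smul t x) (smul t x')
  | act_congr {n : ℕ} {k : ℤ} (σ : Equiv.Perm (Fin n)) {x x' : LTerm K n k} :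
      Rel K x x' → Rel K (act σ x) (act σ x')
  | comp_congr_left {m n r : ℕ} {a b c : ℤ} (i : ℕ) (hi : i < m) (hr : m + n = r + 1)
      (hd : a + b = c) {x x' : LTerm K m a} (y : LTerm K n b) :
      Rel K x x' → Rel K (comp i hi hr hd x y) (comp i hi hr hd x' y)
  | comp_congr_right {m n r : ℕ} {a b c : ℤ} (i : ℕ) (hi : i < m) (hr : m + n = r + 1)
      (hd : a + b = c) (x : LTerm K m a) {y y' : LTerm K n b} :
      Rel K y y' → Rel K (comp i hi hr hd x y) (comp i hi hr hd x y')
  | act_add {n : ℕ} {k : ℤ} (σ : Equiv.Perm (Fin n)) (x y : LTerm K n k) :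
      Rel K (act σ (x.add y)) ((act σ x).add (act σ y))
  | act_smul {n : ℕ} {k : ℤ} (σ : Equiv.Perm (Fin n)) (t : K) (x : LTerm K n k) :
      Rel K (act σ (smul t x)) (smul t (act σ x))
  | comp_add_left {m n r : ℕ} {a b c : ℤ} (i : ℕ) (hi : i < m) (hr : m + n = r + 1)
      (hd : a + b = c) (x x' : LTerm K m a) (y : LTerm K n b) :
      Rel K (comp i hi hr hd (x.add x') y) ((comp i hi hr hd x y).add (comp i hi hr hd x' y))
  | comp_smul_left {m n r : ℕ} {a b c : ℤ} (i : ℕ) (hi : i < m) (hr : m + n = r + 1)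
      (hd : a + b = c) (t : K) (x : LTerm K m a) (y : LTerm K n b) :
      Rel K (comp i hi hr hd (smul t x) y) (smul t (comp i hi hr hd x y))
  | comp_add_right {m n r : ℕ} {a b c : ℤ} (i : ℕ) (hi : i < m) (hr : m + n = r + 1)
      (hd : a + b = c) (x : LTerm K m a) (y y' : LTerm K n b) :
      Rel K (comp i hi hr hd x (y.add y')) ((comp i hi hr hd x y).add (comp i hi hr hd x y'))
  | comp_smul_right {m n r : ℕ} {a b c : ℤ} (i : ℕ) (hi : i < m) (hr : m + n = r + 1)
      (hd : a + b = c) (t : K) (x : LTerm K m a) (y : LTerm K n b) :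
      Rel K (comp i hi hr hd x (smul t y)) (smul t (comp i hi hr hd x y))
  | act_one {n : ℕ} {k : ℤ} (x : LTerm K n k) : Rel K (act 1 x) x
  | act_mul {n : ℕ} {k : ℤ} (σ τ : Equiv.Perm (Fin n)) (x : LTerm K n k) :
      Rel K (act (σ * τ) x) (act τ (act σ x))
  | one_comp {n : ℕ} {a : ℤ} (hi : 0 < 1) (hr : 1 + n = n + 1) (hd : 0 + a = a)
      (x : LTerm K n a) : Rel K (comp 0 hi hr hd one x) x
  | comp_one {m : ℕ} {a : ℤ} (i : ℕ) (hi : i < m) (hr : m + 1 = m + 1) (hd : a + 0 = a)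
      (x : LTerm K m a) : Rel K (comp i hi hr hd x one) x
  | comp_assoc {m n p r s t : ℕ} {a b c e f g : ℤ} (i j : ℕ) (hi : i < m) (hj : j < n)
      (hr : m + n = r + 1) (hs : n + p = s + 1) (hij : i + j < r)
      (ht : r + p = t + 1) (ht' : m + s = t + 1)
      (he : a + b = e) (hg : b + c = g) (hf : e + c = f) (hf' : a + g = f)
      (x : LTerm K m a) (y : LTerm K n b) (z : LTerm K p c) :
      Rel K (comp (i + j) hij ht hf (comp i hi hr he x y) z)
        (comp i hi ht' hf' x (comp j hj hs hg y z))
  | comp_comm {m n p r s t : ℕ} {a b c e f g : ℤ} (i k l : ℕ) (hik : i < k)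
      (hi : i < m) (hk : k < m) (hl : l + 1 = k + n)
      (hr : m + n = r + 1) (hs : m + p = s + 1) (hlr : l < r) (his : i < s)
      (ht : r + p = t + 1) (ht' : s + n = t + 1)
      (he : a + b = e) (hg : a + c = g) (hf : e + c = f) (hf' : g + b = f)
      (x : LTerm K m a) (y : LTerm K n b) (z : LTerm K p c) :
      Rel K (comp l hlr ht hf (comp i hi hr he x y) z)
        (smul (koszulSign K (b * c)) (comp i his ht' hf' (comp k hk hs hg x z) y))
  | comp_act {m n r : ℕ} {a b c : ℤ} (i : Fin m) (hr : m + n = r + 1) (hd : a + b = c)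
      (σ : Equiv.Perm (Fin m)) (ρ : Equiv.Perm (Fin n)) (τ : Equiv.Perm (Fin r))
      (h : IsBlockPerm i σ ρ τ) (x : LTerm K m a) (y : LTerm K n b) :
      Rel K (comp i i.isLt hr hd (act σ x) (act ρ y))
        (act τ (comp (σ i) (σ i).isLt hr hd x y))
  | act_ell {n : ℕ} (σ : Equiv.Perm (Fin n)) : Rel K (act σ (ell n)) (ell n)

/-- The operations of arity `n` and degree `k` of the free symmetric operad on the `ℓ n`. -/
def FreeL (K : Type u) [Field K] (n : ℕ) (k : ℤ) : Type u := Quot (@LTerm.Rel K _ n k)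

instance FreeL.zero (K : Type u) [Field K] (n : ℕ) (k : ℤ) : Zero (FreeL K n k) :=
  ⟨Quot.mk _ (.zero n k)⟩

instance FreeL.add (K : Type u) [Field K] (n : ℕ) (k : ℤ) : Add (FreeL K n k) :=
  ⟨Quot.map₂ .add (fun x _ _ h => .add_congr_right x h) (fun _ _ y h => .add_congr_left y h)⟩

instance FreeL.neg (K : Type u) [Field K] (n : ℕ) (k : ℤ) : Neg (FreeL K n k) :=
  ⟨Quot.map (.smul (-1)) (fun _ _ h => .smul_congr (-1) h)⟩

instance FreeL.addCommGroup (K : Type u) [Field K] (n : ℕ) (k : ℤ) :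
    AddCommGroup (FreeL K n k) where
  add_assoc := by
    rintro ⟨x⟩ ⟨y⟩ ⟨z⟩
    exact Quot.sound (.add_assoc x y z)
  zero_add := by
    rintro ⟨x⟩
    exact Quot.sound (.zero_add x)
  add_zero := by
    rintro ⟨x⟩
    exact (Quot.sound (.add_comm x (.zero n k))).trans (Quot.sound (.zero_add x))
  add_comm := by
    rintro ⟨x⟩ ⟨y⟩
    exact Quot.sound (.add_comm x y)
  neg_add_cancel := by
    rintro ⟨x⟩
    have h1 : Quot.mk (@LTerm.Rel K _ n k) ((LTerm.smul (-1) x).add x) =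
        Quot.mk _ ((LTerm.smul (-1) x).add (LTerm.smul 1 x)) :=
      (congrArg (Quot.map (LTerm.add (LTerm.smul (-1) x)) fun _ _ h => .add_congr_right _ h)
        (Quot.sound (LTerm.Rel.one_smul x))).symm
    have h2 := Quot.sound (LTerm.Rel.add_smul (-1 : K) 1 x)
    rw [neg_add_cancel] at h2
    exact h1.trans (h2.symm.trans (Quot.sound (.zero_smul x)))
  nsmul := nsmulRec
  zsmul := zsmulRec

instance FreeL.module (K : Type u) [Field K] (n : ℕ) (k : ℤ) : Module K (FreeL K n k) :=
  letI : SMul K (FreeL K n k) := ⟨fun t => Quot.map (.smul t) (fun _ _ h => .smul_congr t h)⟩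
  Module.ofMinimalAxioms
    (by rintro t ⟨x⟩ ⟨y⟩; exact Quot.sound (.smul_add t x y))
    (by rintro s t ⟨x⟩; exact Quot.sound (.add_smul s t x))
    (by rintro s t ⟨x⟩; exact Quot.sound (.mul_smul s t x))
    (by rintro ⟨x⟩; exact Quot.sound (.one_smul x))

/-- The graded symmetric operad underlying the curved `L∞` operad: the free operad on generators
`ℓ n`, for `n ≥ 0`, of arity `n` and degree `-1`, with the symmetric groups acting trivially on
the generators. -/
def CLInf (K : Type u) [Field K] : GrOperad K where
  obj := FreeL K
  one := Quot.mk _ .one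
  act σ :=
    { toFun := Quot.map (.act σ) (fun _ _ h => .act_congr σ h)
      map_add' := by
        rintro ⟨x⟩ ⟨y⟩
        exact Quot.sound (.act_add σ x y)
      map_smul' := by
        rintro t ⟨x⟩
        exact Quot.sound (.act_smul σ t x) }
  comp i hi hr hd := LinearMap.mk₂ K
    (Quot.map₂ (.comp i hi hr hd) (fun x _ _ h => .comp_congr_right i hi hr hd x h)
      (fun _ _ y h => .comp_congr_left i hi hr hd y h))
    (by rintro ⟨x⟩ ⟨x'⟩ ⟨y⟩; exact Quot.sound (.comp_add_left i hi hr hd x x' y))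
    (by rintro t ⟨x⟩ ⟨y⟩; exact Quot.sound (.comp_smul_left i hi hr hd t x y))
    (by rintro ⟨x⟩ ⟨y⟩ ⟨y'⟩; exact Quot.sound (.comp_add_right i hi hr hd x y y'))
    (by rintro t ⟨x⟩ ⟨y⟩; exact Quot.sound (.comp_smul_right i hi hr hd t x y))
  act_one := by
    rintro n k ⟨x⟩
    exact Quot.sound (.act_one x)
  act_mul := by
    rintro n k σ τ ⟨x⟩
    exact Quot.sound (.act_mul σ τ x)
  one_comp := by
    rintro n a hi hr hd ⟨x⟩
    exact Quot.sound (.one_comp hi hr hd x)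
  comp_one := by
    rintro m a i hi hr hd ⟨x⟩
    exact Quot.sound (.comp_one i hi hr hd x)
  comp_assoc := by
    rintro m n p r s t a b c e f g i j hi hj hr hs hij ht ht' he hg hf hf' ⟨x⟩ ⟨y⟩ ⟨z⟩
    exact Quot.sound (.comp_assoc i j hi hj hr hs hij ht ht' he hg hf hf' x y z)
  comp_comm := by
    rintro m n p r s t a b c e f g i k l hik hi hk hl hr hs hlr his ht ht' he hg hf hf' ⟨x⟩ ⟨y⟩ ⟨z⟩
    exact Quot.sound
      (.comp_comm i k l hik hi hk hl hr hs hlr his ht ht' he hg hf hf' x y z)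
  comp_act := by
    rintro m n r a b c i hr hd σ ρ τ h ⟨x⟩ ⟨y⟩
    exact Quot.sound (.comp_act i hr hd σ ρ τ h x y)

/-- The generator `ℓ n` of the curved `L∞` operad. -/
def CLInf.ell (K : Type u) [Field K] (n : ℕ) : (CLInf K).obj n (-1) := Quot.mk _ (.ell n)

/-- The unshuffles of `n` inputs whose first block has `q` elements: the permutations whose inverse
is increasing on the first `q` and on the last `n - q` elements. -/
def unshuffles (q n : ℕ) : Finset (Equiv.Perm (Fin n)) :=
  Finset.univ.filter fun σ =>
    ∀ s t : Fin n, s < t → ((t : ℕ) < q ∨ q ≤ (s : ℕ)) → σ⁻¹ s < σ⁻¹ t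

/-- The quadratic expression `∑ (ℓ_{p+1} ∘₁ ℓ_q) ^ σ` in a graded operad, the sum being over all
`p, q ≥ 0` with `p + q = n` and all unshuffles `σ` that distribute the `n` inputs over the first
`q` inputs of the composite (those of `ℓ_q`) and its last `p` inputs. -/
def shuffleSum {K : Type u} [Field K] (Q : GrOperad K) (ν : ∀ n : ℕ, Q.obj n (-1)) (n : ℕ) :
    Q.obj n (-1 - 1) :=
  ∑ pq ∈ (Finset.HasAntidiagonal.antidiagonal n).attach, ∑ σ ∈ unshuffles pq.1.2 n,
    Q.act σ (Q.comp 0 (Nat.succ_pos pq.1.1)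
      (show pq.1.1 + 1 + pq.1.2 = n + 1 by
        have := Finset.HasAntidiagonal.mem_antidiagonal.mp pq.2
        omega)
      (show (-1 : ℤ) + -1 = -1 - 1 by norm_num) (ν (pq.1.1 + 1)) (ν pq.1.2))

/-- The generators `ℓ n` of the curved `L∞` operad with `n > 0`. -/
inductive CLInf.IsPosGen (K : Type u) [Field K] : ∀ (n : ℕ) (k : ℤ), (CLInf K).obj n k → Prop
  | ell (n : ℕ) : 0 < n → IsPosGen K n (-1) (CLInf.ell K n)

/-- The suboperad of the curved `L∞` operad generated by the `ℓ n` with `n > 0`. -/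
def CLInf.base (K : Type u) [Field K] : Suboperad (CLInf K) :=
  Suboperad.closure fun n k => {x | CLInf.IsPosGen K n k x}

/-! The whole proof is driven by one operation: the derivation `CLInf.addInput` of degree 0, which
adds a new first input and sends ℓ_n to ℓ_{n+1}. Sorting the unshuffles of n+1 inputs by the block
that receives the first input shows that the quadratic expression for n+1 is `addInput` of the one
for n (`shuffleSum_succ`). Hence its symmetry follows by induction, the differential commutes with
`addInput`, and d²ℓ_n = 0 reduces to n = 0. There the two terms in ℓ_1, ℓ_1, ℓ_0 cancel, and ℓ_2
with two copies of the odd ℓ_0 inserted is its own negative, so it vanishes. All derivations are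
obtained as morphisms into the square-zero extensions `tangent` and `pointExt`, where freeness
provides them.

The weight-raising part d₁ kills ℓ_0 and sends ℓ_n to −ℓ_{n+1} ∘₁ ℓ_0 for n > 0. The rest preserves
the suboperad without ℓ_0 because `addInput` does.

For initiality, let Q be any object, with Q₀ and κ, and let D (`kappaDerivative`) be the derivation
of degree 1 that kills Q₀ and sends κ to the identity; it turns a κ into a new first input. Since
dℓ_n + ℓ_{n+1} ∘₁ ℓ_0 lies in the suboperad without ℓ_0, a morphism must send ℓ_0 to κ and ℓ_{n+1}
to −D d of the image of ℓ_n. This proves uniqueness and dictates the images ν_n (`generator`).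

For existence, split d²ν_n = 0 by the number of κ (`generator_relation`). The part with two κ says
that ν_{n+2} is invariant under exchange of its first two inputs; the part with one κ is a recursion
for the κ-free part of dν_n. On Q₀ the map (−1)^k D d, on degree k, is a derivation. Extended by κ ↦
ν_1 it becomes the counterpart of `addInput` on Q: it sends ν_n to ν_{n+1} and, by the recursion,
dν_n to dν_{n+1}. The morphism ℓ_n ↦ ν_n intertwines the two, so compatibility with d needs checking
on ℓ_0 only. -/

section koszul
variable (K : Type u) [Field K]

theorem koszulSign_zero : koszulSign K 0 = 1 := by simp [koszulSign]

theorem koszulSign_one : koszulSign K 1 = -1 := by simp [koszulSign]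

theorem koszulSign_add (a b : ℤ) : koszulSign K (a + b) = koszulSign K a * koszulSign K b := by
  simp [koszulSign, Int.negOnePow_add]

theorem koszulSign_neg (a : ℤ) : koszulSign K (-a) = koszulSign K a := by
  simp [koszulSign, Int.negOnePow_neg]

theorem koszulSign_sub (a b : ℤ) : koszulSign K (a - b) = koszulSign K a * koszulSign K b := by
  rw [sub_eq_add_neg, koszulSign_add, koszulSign_neg]

theorem koszulSign_mul_self (a : ℤ) : koszulSign K a * koszulSign K a = 1 := by
  rw [← koszulSign_add]
  simp [koszulSign, ← two_mul]

end koszul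

/-! ### Permutations that move or add one input. -/

/-- The permutation of `r` inputs carrying input `0` to `i` and keeping the order of the others. -/
def slotCycle (r i : ℕ) : Equiv.Perm (Fin r) :=
  if h : i < r then (Fin.cycleRange ⟨i, h⟩).symm else 1

theorem slotCycle_val {r i : ℕ} (h : i < r) (s : Fin r) :
    (slotCycle r i s : ℕ) = if (s : ℕ) = 0 then i else if (s : ℕ) ≤ i then s - 1 else s := by
  obtain _ | r := r
  · exact s.elim0
  rw [slotCycle, dif_pos h]
  refine Fin.cases ?_ (fun t => ?_) s
  · simp
  · rw [Fin.cycleRange_symm_succ]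
    simp only [Fin.succAbove, Fin.lt_def, Fin.val_castSucc, Fin.val_succ]
    split_ifs <;> simp_all; omega

theorem slotCycle_zero (r : ℕ) : slotCycle r 0 = 1 := by
  ext s
  rw [slotCycle_val (by have := s.2; omega)]
  split_ifs <;> simp <;> omega

/-- The permutation of `n + 1` inputs fixing input `0` and acting as `σ` on the others. -/
def extendPerm {n : ℕ} (σ : Equiv.Perm (Fin n)) : Equiv.Perm (Fin (n + 1)) :=
  Equiv.Perm.decomposeFin.symm (0, σ)

@[simp] theorem extendPerm_zero {n : ℕ} (σ : Equiv.Perm (Fin n)) : extendPerm σ 0 = 0 := by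
  simp [extendPerm]

@[simp] theorem extendPerm_succ {n : ℕ} (σ : Equiv.Perm (Fin n)) (s : Fin n) :
    extendPerm σ s.succ = (σ s).succ := by
  simp [extendPerm, Equiv.Perm.decomposeFin_symm_apply_succ]

theorem extendPerm_one (n : ℕ) : extendPerm (1 : Equiv.Perm (Fin n)) = 1 := by
  ext s
  refine Fin.cases ?_ (fun t => ?_) s <;> simp

theorem extendPerm_mul {n : ℕ} (σ τ : Equiv.Perm (Fin n)) :
    extendPerm (σ * τ) = extendPerm σ * extendPerm τ := by
  ext s
  refine Fin.cases ?_ (fun t => ?_) s <;> simp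

theorem extendPerm_val {n : ℕ} (σ : Equiv.Perm (Fin n)) (t : Fin n) (s : Fin (n + 1))
    (h : (s : ℕ) = t + 1) : (extendPerm σ s : ℕ) = σ t + 1 := by
  obtain rfl : s = t.succ := Fin.ext h
  simp

theorem extendPerm_val_zero {n : ℕ} (σ : Equiv.Perm (Fin n)) (s : Fin (n + 1))
    (h : (s : ℕ) = 0) : (extendPerm σ s : ℕ) = 0 := by
  obtain rfl : s = 0 := Fin.ext h
  simp

theorem isBlockPerm_extendPerm {m n r : ℕ} {i : Fin m} {σ : Equiv.Perm (Fin m)}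
    {ρ : Equiv.Perm (Fin n)} {τ : Equiv.Perm (Fin r)} (h : IsBlockPerm i σ ρ τ) :
    IsBlockPerm i.succ (extendPerm σ) ρ (extendPerm τ) := by
  constructor
  · intro j s hs
    have hs' : (s : ℕ) = (i + j : ℕ) + 1 := by simp at hs; omega
    have h2 := h.1 j ⟨i + j, by have := s.2; omega⟩ rfl
    rw [extendPerm_val τ ⟨i + j, by have := s.2; omega⟩ s hs', h2]
    simp; omega
  · intro k s hk hs
    revert hk hs
    refine Fin.cases ?_ (fun k => ?_) k
    · intro _ hs
      simp [outerSlot] at hs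
      simp [hs, outerSlot]
    · intro hk hs
      have hk' : k ≠ i := fun e => hk (by rw [e])
      have e0 : outerSlot i.succ n k.succ = outerSlot i n k + 1 := by
        have : (k : ℕ) ≠ i := fun e => hk' (Fin.ext e)
        simp only [outerSlot, Fin.val_succ]; split_ifs <;> omega
      have hs' : (s : ℕ) = outerSlot i n k + 1 := hs.trans e0
      have h2 := h.2 k ⟨outerSlot i n k, by have := s.2; omega⟩ hk' rfl
      rw [extendPerm_val τ ⟨outerSlot i n k, by have := s.2; omega⟩ s hs', h2]
      have : (σ k : ℕ) ≠ σ i := fun e => hk' (σ.injective (Fin.ext e))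
      simp only [extendPerm_succ, outerSlot, Fin.val_succ]; split_ifs <;> omega

/-! ### Equivariance of partial composites, and the block permutations that occur. -/

namespace GrOperad
variable {K : Type u} [Field K] (R : GrOperad K)

theorem comp_act_of_val {m n r : ℕ} {a b c : ℤ} (i j : ℕ) (hi : i < m) (hj : j < m)
    (hr : m + n = r + 1) (hd : a + b = c) (σ : Equiv.Perm (Fin m)) (ρ : Equiv.Perm (Fin n))
    (τ : Equiv.Perm (Fin r)) (hσ : (σ ⟨i, hi⟩ : ℕ) = j) (h : IsBlockPerm ⟨i, hi⟩ σ ρ τ)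
    (x : R.obj m a) (y : R.obj n b) :
    R.comp i hi hr hd (R.act σ x) (R.act ρ y) = R.act τ (R.comp j hj hr hd x y) := by
  subst hσ
  exact R.comp_act ⟨i, hi⟩ hr hd σ ρ τ h x y

theorem comp_act_left {m n r : ℕ} {a b c : ℤ} (i j : ℕ) (hi : i < m) (hj : j < m)
    (hr : m + n = r + 1) (hd : a + b = c) (σ : Equiv.Perm (Fin m))
    (τ : Equiv.Perm (Fin r)) (hσ : (σ ⟨i, hi⟩ : ℕ) = j)
    (h : IsBlockPerm ⟨i, hi⟩ σ (1 : Equiv.Perm (Fin n)) τ) (x : R.obj m a) (y : R.obj n b) :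
    R.comp i hi hr hd (R.act σ x) y = R.act τ (R.comp j hj hr hd x y) := by
  rw [← R.comp_act_of_val i j hi hj hr hd σ 1 τ hσ h, R.act_one]

theorem comp_act_right {m n r : ℕ} {a b c : ℤ} (i : ℕ) (hi : i < m)
    (hr : m + n = r + 1) (hd : a + b = c) (ρ : Equiv.Perm (Fin n))
    (τ : Equiv.Perm (Fin r)) (h : IsBlockPerm ⟨i, hi⟩ 1 ρ τ)
    (x : R.obj m a) (y : R.obj n b) :
    R.comp i hi hr hd x (R.act ρ y) = R.act τ (R.comp i hi hr hd x y) := by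
  rw [← R.comp_act_of_val i i hi hi hr hd 1 ρ τ rfl h, R.act_one]

end GrOperad

section blocks

/-- Permutations of the outer operation that move the slot `i` and keep the order of the others. -/
theorem isBlockPerm_slotCycle_gt {m n r : ℕ} (c i : ℕ) (hi : i < m) (hc : c < i)
    (hr : m + n = r + 1) :
    IsBlockPerm ⟨i, hi⟩ (slotCycle m c) (1 : Equiv.Perm (Fin n)) (slotCycle r c) := by
  constructor
  · intro j s hs
    have := s.2; have := j.2
    rw [slotCycle_val (by omega), slotCycle_val (by omega)]
    simp only [Equiv.Perm.one_apply] at hs ⊢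
    split_ifs <;> omega
  · intro k s hk hs
    have := s.2; have := k.2
    have : (k : ℕ) ≠ i := fun e => hk (Fin.ext e)
    rw [slotCycle_val (by simp only [outerSlot] at *; split_ifs at * <;> omega)]
    rw [slotCycle_val (by omega), slotCycle_val (by omega)]
    simp only [outerSlot] at *
    split_ifs at * <;> omega

/-- Moving input `c` to the front shifts the earlier input `i` to `i + 1`. In the composite, `c`
itself has been pushed to `l = c + n - 1` by the block inserted before it. -/
theorem isBlockPerm_slotCycle_le {m n r : ℕ} (c i l : ℕ) (hi : i + 1 < m) (hc : i < c) (hcm : c < m)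
    (hl : l + 1 = c + n) (hr : m + n = r + 1) :
    IsBlockPerm ⟨i + 1, hi⟩ (slotCycle m c) (1 : Equiv.Perm (Fin n)) (slotCycle r l) := by
  constructor
  · intro j s hs
    have := s.2; have := j.2
    rw [slotCycle_val (by omega), slotCycle_val (by omega)]
    simp only [Equiv.Perm.one_apply] at hs ⊢
    split_ifs <;> first | contradiction | omega
  · intro k s hk hs
    have := s.2; have := k.2
    have : (k : ℕ) ≠ i + 1 := fun e => hk (Fin.ext e)
    rw [slotCycle_val (by omega), slotCycle_val (by omega), slotCycle_val (by omega)]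
    simp only [outerSlot] at *
    split_ifs at * <;> omega

/-- An input added in front of the inner operation sits at position `i` of the composite, or `σ i`
after permuting. The two cycles bring it to the front, where `extendPerm τ` fixes it. -/
theorem isBlockPerm_conj_extendPerm {m n r : ℕ} {i : Fin m} {σ : Equiv.Perm (Fin m)}
    {ρ : Equiv.Perm (Fin n)} {τ : Equiv.Perm (Fin r)} (hr : m + n = r + 1)
    (h : IsBlockPerm i σ ρ τ) :
    IsBlockPerm i σ (extendPerm ρ)
      (slotCycle (r + 1) (σ i) * extendPerm τ * (slotCycle (r + 1) i)⁻¹) := by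
  have hi := i.2
  have hσi := (σ i).2
  have key : ∀ (s : Fin (r+1)) (t : Fin (r + 1)), slotCycle (r + 1) i t = s →
      (slotCycle (r + 1) (σ i) * extendPerm τ * (slotCycle (r + 1) i)⁻¹) s =
        slotCycle (r + 1) (σ i) (extendPerm τ t) := by
    rintro s t rfl
    simp
  constructor
  · intro j s hs
    have h2 := s.2
    refine Fin.cases (fun hs => ?_) (fun j hs => ?_) j hs
    · rw [key s 0 (Fin.ext (by rw [slotCycle_val (by omega)]; simpa using hs.symm)),
        slotCycle_val (by omega)]
      simp
    · have h3 := h.1 j ⟨i + j, by simp at hs; omega⟩ rfl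
      rw [key s ⟨i + j + 1, by simp at hs; omega⟩
        (Fin.ext (by rw [slotCycle_val (by omega)]; simp at hs ⊢; omega)),
        slotCycle_val (by omega), extendPerm_val τ ⟨i + j, by simp at hs; omega⟩ _ rfl, h3]
      simp
      omega
  · intro k s hk hs
    have h2 := s.2
    have hk1 : (k : ℕ) ≠ i := fun e => hk (Fin.ext e)
    have hk2 : (σ k : ℕ) ≠ σ i := fun e => hk (σ.injective (Fin.ext e))
    have hk3 := k.2
    have hlt : outerSlot i n k < r := by
      simp only [outerSlot] at *; split_ifs at * <;> omega
    have h3 := h.2 k ⟨outerSlot i n k, hlt⟩ hk rfl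
    rw [key s ⟨outerSlot i n k + 1, by omega⟩ (Fin.ext ?_), slotCycle_val (by omega),
      extendPerm_val τ ⟨outerSlot i n k, hlt⟩ _ rfl, h3]
    · simp only [outerSlot] at *
      split_ifs at * <;> omega
    · rw [slotCycle_val (by omega)]
      simp only [outerSlot] at *
      split_ifs at * <;> omega

/-- Acting on the inner operation by moving its input `j` to the front. -/
theorem isBlockPerm_slotCycle_inner {m n r : ℕ} (i j : ℕ) (hi : i < m) (hj : j < n)
    (hr : m + n = r + 1) :
    IsBlockPerm ⟨i, hi⟩ 1 (slotCycle n j) (slotCycle r (i + j) * (slotCycle r i)⁻¹) := by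
  have key : ∀ (s t : Fin r), slotCycle r i t = s →
      (slotCycle r (i + j) * (slotCycle r i)⁻¹) s = slotCycle r (i + j) t := by
    rintro s t rfl
    simp
  constructor
  · intro l s hs
    have h2 := s.2
    have h3 := l.2
    simp only at hs
    by_cases hl : (l : ℕ) = 0
    · rw [key s ⟨0, by omega⟩ (Fin.ext (by rw [slotCycle_val (by omega)]; simp; omega)),
        slotCycle_val (by omega), slotCycle_val (by omega)]
      simp [hl]
    · rw [key s ⟨i + l, by omega⟩ (Fin.ext (by rw [slotCycle_val (by omega)]; simp; split_ifs <;> omega)),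
        slotCycle_val (by omega), slotCycle_val (by omega)]
      simp
      split_ifs <;> omega
  · intro k s hk hs
    have h2 := s.2
    have hk3 := k.2
    have hk1 : (k : ℕ) ≠ i := fun e => hk (Fin.ext e)
    simp only [outerSlot] at hs
    by_cases hki : (k : ℕ) < i
    · rw [if_pos hki] at hs
      rw [key s ⟨k + 1, by omega⟩ (Fin.ext (by
        rw [slotCycle_val (by omega)]; simp [hki]; omega)), slotCycle_val (by omega)]
      simp [outerSlot, hki]
      omega
    · rw [if_neg hki] at hs
      rw [key s ⟨k + n - 1, by omega⟩ (Fin.ext (by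
        rw [slotCycle_val (by omega)]; simp; split_ifs <;> omega)), slotCycle_val (by omega)]
      simp [outerSlot, hki]
      split_ifs <;> omega

theorem isBlockPerm_nullary {r : ℕ} (σ : Equiv.Perm (Fin r)) (hi : 0 < r + 1) :
    IsBlockPerm ⟨0, hi⟩ (extendPerm σ) (1 : Equiv.Perm (Fin 0)) σ := by
  constructor
  · intro j
    exact j.elim0
  · intro k s hk hs
    obtain ⟨k, rfl⟩ := Fin.exists_succ_eq.2 hk
    simp only [outerSlot, Fin.val_succ] at hs ⊢
    obtain rfl : s = k := Fin.ext (by simpa using hs)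
    change (σ s : ℕ) = if (extendPerm σ s.succ : ℕ) < (extendPerm σ 0 : ℕ) then _ else _
    simp

theorem isBlockPerm_slotCycle_nullary {r i : ℕ} (hi : i < r + 1) :
    IsBlockPerm ⟨0, r.succ_pos⟩ (slotCycle (r + 1) i) (1 : Equiv.Perm (Fin 0))
      (1 : Equiv.Perm (Fin r)) := by
  constructor
  · intro j
    exact j.elim0
  · intro k s hk hs
    have hk' : (k : ℕ) ≠ 0 := fun e => hk (Fin.ext e)
    rw [slotCycle_val hi, slotCycle_val hi, if_neg hk']
    simp only [outerSlot, Equiv.Perm.one_apply] at hs ⊢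
    split_ifs at * <;> first | contradiction | omega

end blocks

/-! ### Square-zero extensions of operads, which turn derivations into morphisms. -/

namespace GrOperad
variable {K : Type u} [Field K] (R : GrOperad K)

theorem comp_assoc_of_eq {m n p r s t : ℕ} {a b c e f g : ℤ} (i j l : ℕ) (hl : l = i + j)
    (hi : i < m) (hj : j < n) (hr : m + n = r + 1) (hs : n + p = s + 1) (hlr : l < r)
    (ht : r + p = t + 1) (ht' : m + s = t + 1)
    (he : a + b = e) (hg : b + c = g) (hf : e + c = f) (hf' : a + g = f)
    (x : R.obj m a) (y : R.obj n b) (z : R.obj p c) :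
    R.comp l hlr ht hf (R.comp i hi hr he x y) z = R.comp i hi ht' hf' x (R.comp j hj hs hg y z) := by
  subst hl
  exact R.comp_assoc i j hi hj hr hs hlr ht ht' he hg hf hf' x y z

/-- The operad `R` extended by an operation `*` of arity `0` and degree `-e`, modulo the composites
containing `*` more than once. The second component `x` of an operation stands for `x ∘ *`, the
composite being taken at the first input of `x`. -/
def pointExt (e : ℤ) (f : ℤ → ℤ) (hf : ∀ k, f k = k + e) : GrOperad K where
  obj n k := R.obj n k × R.obj (n + 1) (f k)
  one := (R.one, 0)
  act σ := (R.act σ).prodMap (R.act (extendPerm σ))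
  comp {m n r a b c} i hi hr hd := LinearMap.mk₂ K
    (fun x y => (R.comp i hi hr hd x.1 y.1,
      koszulSign K (e * b) • R.comp (r := r + 1) (c := f c) (i + 1) (by omega) (by omega)
          (by rw [hf, hf]; omega) x.2 y.1 +
        R.act (slotCycle (r + 1) i) (R.comp (r := r + 1) (c := f c) i hi (by omega)
          (by rw [hf, hf]; omega) x.1 y.2)))
    (fun _ _ _ => by ext <;> simp; abel)
    (fun t _ _ => by
      ext
      · simp
      · simp only [Prod.smul_fst, Prod.smul_snd, map_smul, LinearMap.smul_apply, smul_add,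
          smul_comm t])
    (fun _ _ _ => by ext <;> simp; abel)
    (fun t _ _ => by
      ext
      · simp
      · simp only [Prod.smul_fst, Prod.smul_snd, map_smul, smul_add,
          smul_comm t])
  act_one x := by ext <;> simp [extendPerm_one, R.act_one]
  act_mul σ τ x := by ext <;> simp [extendPerm_mul, R.act_mul]
  one_comp hi hr hd x := by
    ext <;> simp [slotCycle_zero, R.act_one, R.one_comp]
  comp_one i hi hr hd x := by
    ext <;> simp [koszulSign_zero, R.comp_one]
  comp_assoc {m n p r s t a b c e' h' g'} i j hi hj hr hs hij ht ht' he hg hh hh' x y z := by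
    refine Prod.ext (R.comp_assoc i j hi hj hr hs hij ht ht' he hg hh hh' x.1 y.1 z.1) ?_
    have fe := hf a
    have fe' := hf b
    have fe'' := hf c
    have fe1 := hf e'
    have fe2 := hf g'
    have fe3 := hf h'
    -- The point `*` sits in `x`, in `y` or in `z`; each of `h1`, `h2`, `h3` settles one case.
    have h1 : R.comp (r := t + 1) (c := f h') (i + j + 1) (by omega) (by omega) (by omega)
        (R.comp (r := r + 1) (c := f e') (i + 1) (by omega) (by omega) (by omega) x.2 y.1) z.1 =
        R.comp (r := t + 1) (c := f h') (i + 1) (by omega) (by omega) (by omega) x.2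
          (R.comp j hj hs hg y.1 z.1) :=
      R.comp_assoc_of_eq (i + 1) j (i + j + 1) (by omega) (by omega) hj (by omega) hs
        (by omega) (by omega) (by omega) (by omega) hg (by omega) (by omega) _ _ _
    have h2 : R.comp (r := t + 1) (c := f h') (i + j + 1) (by omega) (by omega) (by omega)
        (R.act (slotCycle (r + 1) i) (R.comp (r := r + 1) (c := f e') i hi (by omega) (by omega)
          x.1 y.2)) z.1 =
        R.act (slotCycle (t + 1) i) (R.comp (r := t + 1) (c := f h') i hi (by omega) (by omega) x.1
          (R.comp (r := s + 1) (c := f g') (j + 1) (by omega) (by omega) (by omega) y.2 z.1)) := by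
      rw [R.comp_act_left (i + j + 1) (i + j + 1) _ (by omega) _ _ _ _
        (by rw [slotCycle_val (by omega)]; simp)
        (isBlockPerm_slotCycle_gt i (i + j + 1) (by omega) (by omega) (by omega))]
      congr 1
      exact R.comp_assoc i (j + 1) hi (by omega) (by omega) (by omega) (by omega) (by omega)
        (by omega) (by omega) (by omega) (by omega) (by omega) _ _ _
    have h3 : R.act (slotCycle (t + 1) (i + j)) (R.comp (r := t + 1) (c := f h') (i + j) hij
        (by omega) (by omega) (R.comp i hi hr he x.1 y.1) z.2) =
        R.act (slotCycle (t + 1) i) (R.comp (r := t + 1) (c := f h') i hi (by omega) (by omega) x.1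
          (R.act (slotCycle (s + 1) j) (R.comp (r := s + 1) (c := f g') j hj (by omega) (by omega)
            y.1 z.2))) := by
      rw [R.comp_act_right i hi _ _ _ _ (isBlockPerm_slotCycle_inner i j hi (by omega) (by omega)),
        ← R.act_mul, inv_mul_cancel_right, R.comp_assoc i j hi hj hr (s := s + 1) (by omega) hij
          (by omega) (by omega) he (g := f g') (by omega) (by omega) (by omega)]
    have e0 : koszulSign K (e * c) * koszulSign K (e * b) = koszulSign K (e * g') := by
      rw [← hg, mul_add, koszulSign_add, mul_comm]
    simp only [LinearMap.mk₂_apply, map_add, map_smul, LinearMap.add_apply, LinearMap.smul_apply,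
      h1, h2, h3, smul_add, smul_smul, e0]
    rw [add_assoc]
  comp_comm {m n p r s t a b c e' h' g'} i k l hik hi hk hl hr hs hlr his ht ht' he hg hh hh'
      x y z := by
    refine Prod.ext (R.comp_comm i k l hik hi hk hl hr hs hlr his ht ht' he hg hh hh' x.1 y.1 z.1) ?_
    have fe := hf a
    have fe' := hf b
    have fe'' := hf c
    have fe1 := hf e'
    have fe2 := hf g'
    have fe3 := hf h'
    -- The same three cases. When `*` sits in `y` or `z`, that factor has degree shifted by `e`, and
    -- the sign of moving `*` past the other factor (`e1`, `e2`) makes up for the change.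
    have h1 : R.comp (r := t + 1) (c := f h') (l + 1) (by omega) (by omega) (by omega)
        (R.comp (r := r + 1) (c := f e') (i + 1) (by omega) (by omega) (by omega) x.2 y.1) z.1 =
        koszulSign K (b * c) • R.comp (r := t + 1) (c := f h') (i + 1) (by omega) (by omega)
          (by omega) (R.comp (r := s + 1) (c := f g') (k + 1) (by omega) (by omega) (by omega)
            x.2 z.1) y.1 :=
      R.comp_comm (i + 1) (k + 1) (l + 1) (by omega) (by omega) (by omega) (by omega) (by omega)
        (by omega) (by omega) (by omega) (by omega) (by omega) (by omega) (by omega) (by omega)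
        (by omega) _ _ _
    have h2 : R.comp (r := t + 1) (c := f h') (l + 1) (by omega) (by omega) (by omega)
        (R.act (slotCycle (r + 1) i) (R.comp (r := r + 1) (c := f e') i hi (by omega) (by omega)
          x.1 y.2)) z.1 =
        koszulSign K (f b * c) • R.act (slotCycle (t + 1) i) (R.comp (r := t + 1) (c := f h') i his
          (by omega) (by omega) (R.comp k hk hs hg x.1 z.1) y.2) := by
      rw [R.comp_act_left (l + 1) (l + 1) _ (by omega) _ _ _ _
        (by rw [slotCycle_val (by omega)]; simp; omega)
        (isBlockPerm_slotCycle_gt i (l + 1) (by omega) (by omega) (by omega)), ← map_smul]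
      congr 1
      exact R.comp_comm i k (l + 1) hik hi hk (by omega) (by omega)
        (by omega) (by omega) (by omega) (by omega) (by omega) (by omega) (by omega) (by omega)
        (by omega) _ _ _
    have h3 : R.act (slotCycle (t + 1) l) (R.comp (r := t + 1) (c := f h') l hlr
        (by omega) (by omega) (R.comp i hi hr he x.1 y.1) z.2) =
        koszulSign K (b * f c) • R.comp (r := t + 1) (c := f h') (i + 1) (by omega) (by omega)
          (by omega) (R.act (slotCycle (s + 1) k) (R.comp (r := s + 1) (c := f g') k hk
            (by omega) (by omega) x.1 z.2)) y.1 := by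
      rw [R.comp_act_left (i + 1) i _ (by omega) _ _ _ (slotCycle (t + 1) l)
        (by rw [slotCycle_val (by omega)]; simp; omega)
        (isBlockPerm_slotCycle_le k i l (by omega) (by omega) (by omega) (by omega) (by omega)),
        ← map_smul]
      congr 1
      exact R.comp_comm i k l hik hi hk (by omega) (by omega)
        (by omega) (by omega) (by omega) (by omega) (by omega) (by omega) (by omega) (by omega)
        (by omega) _ _ _
    have e1 : koszulSign K (e * c) * koszulSign K (f b * c) = koszulSign K (b * c) := by
      rw [hf, add_mul, koszulSign_add, mul_left_comm, koszulSign_mul_self, mul_one]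
    have e2 : koszulSign K (b * f c) = koszulSign K (b * c) * koszulSign K (e * b) := by
      rw [hf, mul_add, koszulSign_add, mul_comm b e]
    simp only [LinearMap.mk₂_apply, map_add, map_smul, LinearMap.add_apply, LinearMap.smul_apply,
      h1, h2, h3, smul_add, smul_smul, Prod.smul_snd, e1, e2]
    rw [show koszulSign K (e * c) * (koszulSign K (e * b) * koszulSign K (b * c)) =
      koszulSign K (b * c) * (koszulSign K (e * b) * koszulSign K (e * c)) by ring]
    abel
  comp_act {m n r a b c} i hr hd σ ρ τ h x y := by
    refine Prod.ext (R.comp_act i hr hd σ ρ τ h x.1 y.1) ?_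
    have fe := hf a
    have fe' := hf b
    have fe'' := hf c
    have hi := i.2
    have hσi := (σ i).2
    have h1 := R.comp_act_of_val (c := f c) (i + 1) (σ i + 1) (by omega) (by omega) (by omega)
      (by omega) (extendPerm σ) ρ (extendPerm τ) (extendPerm_val σ i _ rfl)
      (isBlockPerm_extendPerm h) x.2 y.1
    have h2 := R.comp_act (c := f c) i (by omega) (by omega) σ (extendPerm ρ) _
      (isBlockPerm_conj_extendPerm hr h) x.1 y.2
    simp only [LinearMap.mk₂_apply, LinearMap.prodMap_apply, map_add, map_smul, h1, h2,
      ← R.act_mul, inv_mul_cancel_right]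

/-- The operad `R ⊕ R ε` with `ε` of degree `1` and square zero: a morphism to it lifting the
identity of `R` is a derivation of degree `-1`. -/
def tangent : GrOperad K where
  obj n k := R.obj n k × R.obj n (k - 1)
  one := (R.one, 0)
  act σ := (R.act σ).prodMap (R.act σ)
  comp {m n r a b c} i hi hr hd := LinearMap.mk₂ K
    (fun x y => (R.comp i hi hr hd x.1 y.1,
      R.comp i hi hr (show (a - 1) + b = c - 1 by omega) x.2 y.1 +
        koszulSign K a • R.comp i hi hr (show a + (b - 1) = c - 1 by omega) x.1 y.2))
    (fun _ _ _ => by ext <;> simp; abel)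
    (fun t _ _ => by
      ext
      · simp
      · simp only [Prod.smul_fst, Prod.smul_snd, map_smul, LinearMap.smul_apply, smul_add,
          smul_comm t])
    (fun _ _ _ => by ext <;> simp; abel)
    (fun t _ _ => by
      ext
      · simp
      · simp only [Prod.smul_fst, Prod.smul_snd, map_smul, smul_add,
          smul_comm t])
  act_one x := by ext <;> simp [R.act_one]
  act_mul σ τ x := by ext <;> simp [R.act_mul]
  one_comp hi hr hd x := by
    ext <;> simp [R.one_comp, koszulSign_zero]
  comp_one i hi hr hd x := by
    ext <;> simp [R.comp_one]
  comp_assoc {m n p r s t a b c e' h' g'} i j hi hj hr hs hij ht ht' he hg hh hh' x y z := by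
    refine Prod.ext (R.comp_assoc i j hi hj hr hs hij ht ht' he hg hh hh' x.1 y.1 z.1) ?_
    have h1 := R.comp_assoc (e := e' - 1) (f := h' - 1) i j hi hj hr hs hij ht ht' (by omega) hg
      (by omega) (by omega) x.2 y.1 z.1
    have h2 := R.comp_assoc (e := e' - 1) (f := h' - 1) (g := g' - 1) i j hi hj hr hs hij ht ht'
      (by omega) (by omega) (by omega) (by omega) x.1 y.2 z.1
    have h3 := R.comp_assoc (f := h' - 1) (g := g' - 1) i j hi hj hr hs hij ht ht' he (by omega)
      (by omega) (by omega) x.1 y.1 z.2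
    simp only [LinearMap.mk₂_apply, map_add, map_smul, LinearMap.add_apply, LinearMap.smul_apply,
      h1, h2, h3, smul_add, smul_smul, ← koszulSign_add, he, add_assoc]
  comp_comm {m n p r s t a b c e' h' g'} i k l hik hi hk hl hr hs hlr his ht ht' he hg hh hh'
      x y z := by
    refine Prod.ext (R.comp_comm i k l hik hi hk hl hr hs hlr his ht ht' he hg hh hh' x.1 y.1 z.1) ?_
    have h1 := R.comp_comm (e := e' - 1) (f := h' - 1) (g := g' - 1) i k l hik hi hk hl hr hs hlr
      his ht ht' (by omega) (by omega) (by omega) (by omega) x.2 y.1 z.1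
    have h2 := R.comp_comm (e := e' - 1) (f := h' - 1) i k l hik hi hk hl hr hs hlr
      his ht ht' (by omega) hg (by omega) (by omega) x.1 y.2 z.1
    have h3 := R.comp_comm (f := h' - 1) (g := g' - 1) i k l hik hi hk hl hr hs hlr
      his ht ht' he (by omega) (by omega) (by omega) x.1 y.1 z.2
    have e1 : koszulSign K a * koszulSign K ((b - 1) * c) =
        koszulSign K (b * c) * koszulSign K g' := by
      rw [← hg, sub_mul, koszulSign_sub, koszulSign_add, one_mul]; ring
    have e2 : koszulSign K e' * koszulSign K (b * (c - 1)) =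
        koszulSign K (b * c) * koszulSign K a := by
      rw [← he, mul_sub, koszulSign_sub, koszulSign_add, mul_one]
      linear_combination koszulSign K a * koszulSign K (b * c) * koszulSign_mul_self K b
    simp only [LinearMap.mk₂_apply, map_add, map_smul, LinearMap.add_apply, LinearMap.smul_apply,
      h1, h2, h3, smul_add, smul_smul, Prod.smul_snd, e1, e2]
    abel
  comp_act {m n r a b c} i hr hd σ ρ τ h x y := by
    refine Prod.ext (R.comp_act i hr hd σ ρ τ h x.1 y.1) ?_
    simp only [LinearMap.mk₂_apply, LinearMap.prodMap_apply, map_add, map_smul,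
      R.comp_act i hr _ σ ρ τ h]

/-- The operad with a one-dimensional space of operations in each arity, all of degree `0`. -/
def commutative (K : Type u) [Field K] : GrOperad K where
  obj _ k := (⨅ _ : k ≠ 0, ⊥ : Submodule K K)
  one := ⟨1, by simp⟩
  act _ := LinearMap.id
  comp {m n r a b c} i hi hr hd := LinearMap.mk₂ K
    (fun x y => ⟨x.1 * y.1, by
      have hx := x.2
      have hy := y.2
      simp only [Submodule.mem_iInf, Submodule.mem_bot] at hx hy ⊢
      intro hc
      by_cases ha : a = 0
      · rw [hy (by omega), mul_zero]
      · rw [hx ha, zero_mul]⟩)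
    (fun _ _ _ => Subtype.ext (by simp [add_mul])) (fun _ _ _ => Subtype.ext (by simp [mul_assoc]))
    (fun _ _ _ => Subtype.ext (by simp [mul_add]))
    (fun _ _ _ => Subtype.ext (by simp [mul_left_comm]))
  act_one _ := rfl
  act_mul _ _ _ := rfl
  one_comp _ _ _ _ := Subtype.ext (by simp)
  comp_one _ _ _ _ _ := Subtype.ext (by simp)
  comp_assoc _ _ _ _ _ _ _ _ _ _ _ _ _ _ _ _ := Subtype.ext (by simp [mul_assoc])
  comp_comm {m n p r s t a b c e' h' g'} _ _ _ _ _ _ _ _ _ _ _ _ _ _ _ _ _ x y z := by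
    have hy := y.2
    simp only [Submodule.mem_iInf, Submodule.mem_bot] at hy
    refine Subtype.ext ?_
    by_cases hb : b = 0
    · simp [hb, koszulSign_zero, mul_right_comm]
    · simp [hy hb]
  comp_act _ _ _ _ _ _ _ _ _ := rfl

end GrOperad

/-! ### Relations between cycles and extended permutations. -/

section perms

theorem exists_extendPerm_eq {n : ℕ} (σ : Equiv.Perm (Fin (n + 1))) (h : σ 0 = 0) :
    ∃ τ, σ = extendPerm τ := by
  obtain ⟨⟨p, τ⟩, rfl⟩ := Equiv.Perm.decomposeFin.symm.surjective σ
  obtain rfl : p = 0 := by simpa using h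
  exact ⟨τ, rfl⟩

theorem exists_slotCycle_mul_extendPerm_eq {n : ℕ} (σ : Equiv.Perm (Fin (n + 1))) :
    ∃ τ, σ = slotCycle (n + 1) (σ 0) * extendPerm τ := by
  obtain ⟨τ, h⟩ := exists_extendPerm_eq ((slotCycle (n + 1) (σ 0))⁻¹ * σ) (by
    rw [Equiv.Perm.mul_apply, Equiv.Perm.inv_eq_iff_eq]
    ext
    rw [slotCycle_val (by omega)]
    simp)
  exact ⟨τ, by rw [← h, mul_inv_cancel_left]⟩

theorem extendPerm_injective {n : ℕ} : Function.Injective (extendPerm (n := n)) := by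
  intro σ τ h
  have := Equiv.Perm.decomposeFin.symm.injective h
  simpa using this

theorem extendPerm_slotCycle_mul {n i : ℕ} (h : i < n + 1) :
    extendPerm (slotCycle (n + 1) i) * slotCycle (n + 2) 1 = slotCycle (n + 2) (i + 1) := by
  ext s
  rw [Equiv.Perm.mul_apply]
  by_cases h0 : (s : ℕ) = 0
  · rw [extendPerm_val _ 0 _ (by rw [slotCycle_val (by omega)]; simp [h0]), slotCycle_val (by omega),
      slotCycle_val (by omega)]
    simp [h0]
  by_cases h1 : (s : ℕ) = 1
  · rw [extendPerm_val_zero _ _ (by rw [slotCycle_val (by omega)]; simp [h1]),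
      slotCycle_val (by omega)]
    simp [h1]
  · have := s.2
    rw [extendPerm_val _ ⟨s - 1, by omega⟩ _ (by
      rw [slotCycle_val (by omega), if_neg h0, if_neg (by omega)]; simp only; omega),
      slotCycle_val (by omega), slotCycle_val (by omega)]
    simp only
    split_ifs <;> omega

theorem slotCycle_one_mul_self (n : ℕ) : slotCycle (n + 2) 1 * slotCycle (n + 2) 1 = 1 := by
  ext s
  rw [Equiv.Perm.mul_apply, slotCycle_val (by omega), slotCycle_val (by omega)]
  simp only [Equiv.Perm.one_apply]
  split_ifs <;> first | contradiction | omega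

theorem slotCycle_succ_mul {n i : ℕ} (h : i < n + 1) :
    slotCycle (n + 2) (i + 1) * slotCycle (n + 2) 1 = extendPerm (slotCycle (n + 1) i) := by
  rw [← extendPerm_slotCycle_mul h, mul_assoc, slotCycle_one_mul_self, mul_one]

theorem slotCycle_mul_slotCycle_succ {n i : ℕ} (h : i < n + 1) :
    slotCycle (n + 2) i * slotCycle (n + 2) (i + 1) =
      slotCycle (n + 2) (i + 1) * extendPerm (slotCycle (n + 1) i) := by
  ext s
  rw [Equiv.Perm.mul_apply, Equiv.Perm.mul_apply]
  have hs := s.2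
  by_cases h0 : (s : ℕ) = 0
  · rw [slotCycle_val (by omega), slotCycle_val (by omega), slotCycle_val (by omega),
      extendPerm_val_zero _ _ h0]
    simp [h0]
  · rw [slotCycle_val (by omega), slotCycle_val (by omega), slotCycle_val (by omega),
      extendPerm_val _ ⟨s - 1, by omega⟩ _ (by simp; omega), slotCycle_val (by omega)]
    simp [h0]
    split_ifs <;> omega

end perms

namespace GrOperad
variable {K : Type u} [Field K] (R : GrOperad K)

/-- The symmetric group is generated by the permutations fixing the first input together with the
transposition of the first two inputs. -/
theorem act_eq_self_of_generators {n : ℕ} {k : ℤ} (x : R.obj (n + 2) k)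
    (h : ∀ σ, R.act (extendPerm σ) x = x) (h1 : R.act (slotCycle (n + 2) 1) x = x)
    (σ : Equiv.Perm (Fin (n + 2))) : R.act σ x = x := by
  obtain ⟨τ, hτ⟩ := exists_slotCycle_mul_extendPerm_eq σ
  have key : R.act (slotCycle (n + 2) (σ 0)) x = x := by
    obtain h0 | ⟨i, hi⟩ : (σ 0 : ℕ) = 0 ∨ ∃ i, (σ 0 : ℕ) = i + 1 := by
      cases (σ 0 : ℕ) <;> simp
    · rw [h0, slotCycle_zero, R.act_one]
    · have := (σ 0).2
      rw [hi, ← extendPerm_slotCycle_mul (by omega), R.act_mul, h, h1]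
  rw [hτ, R.act_mul, key, h]

/-- Composition at input `1` of an invariant operation. -/
theorem comp_one_slot {m n r : ℕ} {a b c : ℤ} (h0 : 0 < m) (h1 : 1 < m) (hr : m + n = r + 1)
    (hd : a + b = c) (x : R.obj m a) (hx : R.act (slotCycle m 1) x = x) (y : R.obj n b) :
    R.comp 1 h1 hr hd x y = R.act (slotCycle r n) (R.comp 0 h0 hr hd x y) := by
  rw [← R.comp_act_left 1 0 h1 h0 hr hd (slotCycle m 1) (slotCycle r n)
    (by rw [slotCycle_val h1]; simp)
    (isBlockPerm_slotCycle_le 1 0 n h1 (by omega) h1 (by omega) hr), hx]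

end GrOperad

/-! ### Induction on, and universal property of, the free operad. -/

namespace CLInf
variable {K : Type u} [Field K]

theorem induction {motive : ∀ {n : ℕ} {k : ℤ}, (CLInf K).obj n k → Prop}
    (ell : ∀ n, motive (CLInf.ell K n)) (one : motive (CLInf K).one)
    (zero : ∀ n k, motive (0 : (CLInf K).obj n k))
    (add : ∀ {n k} (x y : (CLInf K).obj n k), motive x → motive y → motive (x + y))
    (smul : ∀ {n k} (t : K) (x : (CLInf K).obj n k), motive x → motive (t • x))
    (act : ∀ {n k} (σ : Equiv.Perm (Fin n)) (x : (CLInf K).obj n k),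
      motive x → motive ((CLInf K).act σ x))
    (comp : ∀ {m n r : ℕ} {a b c : ℤ} (i : ℕ) (hi : i < m) (hr : m + n = r + 1) (hd : a + b = c)
      (x : (CLInf K).obj m a) (y : (CLInf K).obj n b), motive x → motive y →
      motive ((CLInf K).comp i hi hr hd x y))
    {n : ℕ} {k : ℤ} (x : (CLInf K).obj n k) : motive x := by
  suffices h : ∀ {n : ℕ} {k : ℤ} (x : LTerm K n k), motive (Quot.mk _ x : (CLInf K).obj n k) from
    Quot.ind h x
  clear x
  intro n k x
  induction x with
  | ell n => exact ell n
  | one => exact one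
  | zero n k => exact zero n k
  | add x y hx hy => exact add _ _ hx hy
  | smul t x hx => exact smul t _ hx
  | act σ x hx => exact act σ _ hx
  | comp i hi hr hd x y hx hy => exact comp i hi hr hd _ _ hx hy

theorem act_ell {n : ℕ} (σ : Equiv.Perm (Fin n)) :
    (CLInf K).act σ (ell K n) = ell K n :=
  Quot.sound (.act_ell σ)

variable {P : GrOperad K}

/-- Evaluation of an operadic expression at given values of the symbols. -/
def _root_.LTerm.eval (ν : ∀ n, P.obj n (-1)) : ∀ {n : ℕ} {k : ℤ}, LTerm K n k → P.obj n k
  | _, _, .ell n => ν n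
  | _, _, .one => P.one
  | _, _, .zero _ _ => 0
  | _, _, .add x y => x.eval ν + y.eval ν
  | _, _, .smul t x => t • x.eval ν
  | _, _, .act σ x => P.act σ (x.eval ν)
  | _, _, .comp i hi hr hd x y => P.comp i hi hr hd (x.eval ν) (y.eval ν)

theorem _root_.LTerm.Rel.eval_eq (ν : ∀ n, P.obj n (-1))
    (hν : ∀ n σ, P.act σ (ν n) = ν n) {n : ℕ} {k : ℤ} {x y : LTerm K n k} (h : LTerm.Rel K x y) :
    x.eval ν = y.eval ν := by
  induction h with
  | add_comm x y => exact _root_.add_comm _ _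
  | add_assoc x y z => exact _root_.add_assoc _ _ _
  | zero_add x => exact _root_.zero_add _
  | zero_smul x => exact _root_.zero_smul _ _
  | one_smul x => exact _root_.one_smul _ _
  | mul_smul s t x => exact SemigroupAction.mul_smul _ _ _
  | smul_add t x y => exact _root_.smul_add _ _ _
  | add_smul s t x => exact _root_.add_smul _ _ _
  | act_one x => exact P.act_one _
  | act_mul σ τ x => exact P.act_mul _ _ _
  | one_comp hi hr hd x => exact P.one_comp _ _ _ _
  | comp_one i hi hr hd x => exact P.comp_one _ _ _ _ _
  | comp_assoc => exact P.comp_assoc _ _ _ _ _ _ _ _ _ _ _ _ _ _ _ _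
  | comp_comm => exact P.comp_comm _ _ _ (by assumption) _ _ (by assumption) _ _ _ _ _ _ _ _ _ _ _ _ _
  | comp_act i hr hd σ ρ τ h x y => exact P.comp_act i hr hd σ ρ τ h _ _
  | act_ell σ => exact hν _ σ
  -- What remains are the congruence rules and the linearity of the operations.
  | _ => simp_all [LTerm.eval]

/-- The universal property of the free operad. -/
def lift (ν : ∀ n, P.obj n (-1)) (hν : ∀ n σ, P.act σ (ν n) = ν n) : (CLInf K).Hom P where
  map n k :=
    { toFun := Quot.lift (LTerm.eval ν) fun _ _ h => h.eval_eq ν hν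
      map_add' := by rintro ⟨x⟩ ⟨y⟩; rfl
      map_smul' := by rintro t ⟨x⟩; rfl }
  map_one := rfl
  map_act := by rintro n k σ ⟨x⟩; rfl
  map_comp := by rintro m n r a b c i hi hr hd ⟨x⟩ ⟨y⟩; rfl

theorem hom_ext {f g : (CLInf K).Hom P}
    (h : ∀ n, f.map n (-1) (ell K n) = g.map n (-1) (ell K n)) : f = g := by
  ext n k x
  induction x using CLInf.induction with
  | ell n => exact h n
  | one => rw [f.map_one, g.map_one]
  | zero => simp
  | add x y hx hy => simp [hx, hy]
  | smul t x hx => simp [hx]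
  | act σ x hx => rw [f.map_act, g.map_act, hx]
  | comp i hi hr hd x y hx hy => rw [f.map_comp, g.map_comp, hx, hy]

end CLInf

/-- The exchange of two new inputs and a permutation of the old ones have disjoint supports. -/
theorem extendPerm_extendPerm_mul_slotCycle {n : ℕ} (σ : Equiv.Perm (Fin n)) :
    extendPerm (extendPerm σ) * slotCycle (n + 2) 1 =
      slotCycle (n + 2) 1 * extendPerm (extendPerm σ) := by
  have h0 : slotCycle (n + 2) 1 0 = Fin.succ 0 := Fin.ext (by rw [slotCycle_val (by omega)]; simp)
  have h1 : slotCycle (n + 2) 1 (Fin.succ 0) = 0 := Fin.ext (by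
    rw [slotCycle_val (by omega)]; simp)
  have h2 (s : Fin n) : slotCycle (n + 2) 1 s.succ.succ = s.succ.succ := Fin.ext (by
    rw [slotCycle_val (by omega)]; simp)
  ext s
  refine Fin.cases ?_ (fun s => Fin.cases ?_ (fun s => ?_) s) s
  · simp only [Equiv.Perm.mul_apply, h0, extendPerm_succ, extendPerm_zero]
  · simp only [Equiv.Perm.mul_apply, h1, extendPerm_succ, extendPerm_zero]
  · simp only [Equiv.Perm.mul_apply, h2, extendPerm_succ]

/-! ### Derivations of the free operad, and the derivation that adds an input. -/

namespace CLInf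
variable {K : Type u} [Field K]

section derivation
variable (δ : ∀ n, (CLInf K).obj n (-1 - 1)) (hδ : ∀ n σ, (CLInf K).act σ (δ n) = δ n)

/-- The morphism to the tangent operad lifting the derivation with prescribed values on the
generators. -/
def tangentLift : (CLInf K).Hom (CLInf K).tangent :=
  lift (fun n => (ell K n, δ n)) fun n σ => Prod.ext (act_ell σ) (hδ n σ)

theorem tangentLift_fst {n : ℕ} {k : ℤ} (x : (CLInf K).obj n k) :
    ((tangentLift δ hδ).map n k x).1 = x := by
  induction x using CLInf.induction with
  | ell n => rfl
  | one => rw [GrOperad.Hom.map_one]; rfl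
  | zero => simp; rfl
  | add x y hx hy => rw [map_add]; exact congrArg₂ _ hx hy
  | smul t x hx => rw [map_smul]; exact congrArg _ hx
  | act σ x hx => rw [GrOperad.Hom.map_act]; exact congrArg _ hx
  | comp i hi hr hd x y hx hy =>
    rw [GrOperad.Hom.map_comp]
    exact congrArg₂ (fun x y => (CLInf K).comp i hi hr hd x y) hx hy

/-- The derivation of degree `-1` of the free operad with prescribed values on the generators. -/
def derivation {n : ℕ} {k : ℤ} : (CLInf K).obj n k →ₗ[K] (CLInf K).obj n (k - 1) :=
  (LinearMap.snd K ((CLInf K).obj n k) ((CLInf K).obj n (k - 1))).comp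
    ((tangentLift δ hδ).map n k)

theorem derivation_ell (n : ℕ) : derivation δ hδ (ell K n) = δ n := rfl

theorem derivation_one : derivation δ hδ (CLInf K).one = 0 :=
  congrArg Prod.snd (tangentLift δ hδ).map_one

theorem derivation_act {n : ℕ} {k : ℤ} (σ : Equiv.Perm (Fin n)) (x : (CLInf K).obj n k) :
    derivation δ hδ ((CLInf K).act σ x) = (CLInf K).act σ (derivation δ hδ x) :=
  congrArg Prod.snd ((tangentLift δ hδ).map_act σ x)

theorem derivation_comp {m n r : ℕ} {a b c : ℤ} (i : ℕ) (hi : i < m) (hr : m + n = r + 1)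
    (hd : a + b = c) (x : (CLInf K).obj m a) (y : (CLInf K).obj n b) :
    derivation δ hδ ((CLInf K).comp i hi hr hd x y) =
      (CLInf K).comp i hi hr (show (a - 1) + b = c - 1 by omega) (derivation δ hδ x) y +
        koszulSign K a •
          (CLInf K).comp i hi hr (show a + (b - 1) = c - 1 by omega) x (derivation δ hδ y) := by
  refine (congrArg Prod.snd ((tangentLift δ hδ).map_comp i hi hr hd x y)).trans ?_
  change (CLInf K).comp i hi hr _ _ ((tangentLift δ hδ).map n b y).1 + koszulSign K a •
    (CLInf K).comp i hi hr _ ((tangentLift δ hδ).map m a x).1 _ = _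
  rw [tangentLift_fst, tangentLift_fst]
  rfl

end derivation

section addInput

theorem act_extendPerm_ell (n : ℕ) (σ : Equiv.Perm (Fin n)) :
    ((CLInf K).pointExt 0 (fun k => k) (by simp)).act σ (ell K n, ell K (n + 1)) =
      (ell K n, ell K (n + 1)) :=
  Prod.ext (act_ell _) (act_ell _)

/-- The morphism to the extension by an operation of arity `0` and degree `0` that lifts
`addInput`. -/
def addInputLift : (CLInf K).Hom ((CLInf K).pointExt 0 (fun k => k) (by simp)) :=
  lift (fun n => (ell K n, ell K (n + 1))) act_extendPerm_ell

theorem addInputLift_fst {n : ℕ} {k : ℤ} (x : (CLInf K).obj n k) :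
    (addInputLift.map n k x).1 = x := by
  induction x using CLInf.induction with
  | ell n => rfl
  | one => rw [GrOperad.Hom.map_one]; rfl
  | zero => simp; rfl
  | add x y hx hy => rw [map_add]; exact congrArg₂ _ hx hy
  | smul t x hx => rw [map_smul]; exact congrArg _ hx
  | act σ x hx => rw [GrOperad.Hom.map_act]; exact congrArg _ hx
  | comp i hi hr hd x y hx hy =>
    rw [GrOperad.Hom.map_comp]
    exact congrArg₂ (fun x y => (CLInf K).comp i hi hr hd x y) hx hy

/-- The derivation with `ℓ n ↦ ℓ (n + 1)` that adds a new first input to the operations. -/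
def addInput {n : ℕ} {k : ℤ} : (CLInf K).obj n k →ₗ[K] (CLInf K).obj (n + 1) k :=
  (LinearMap.snd K ((CLInf K).obj n k) ((CLInf K).obj (n + 1) k)).comp (addInputLift.map n k)

theorem addInput_ell (n : ℕ) : addInput (ell K n) = ell K (n + 1) := rfl

theorem addInput_one : addInput (CLInf K).one = 0 :=
  congrArg Prod.snd (addInputLift (K := K)).map_one

theorem addInput_act {n : ℕ} {k : ℤ} (σ : Equiv.Perm (Fin n)) (x : (CLInf K).obj n k) :
    addInput ((CLInf K).act σ x) = (CLInf K).act (extendPerm σ) (addInput x) :=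
  congrArg Prod.snd (addInputLift.map_act σ x)

theorem addInput_comp {m n r : ℕ} {a b c : ℤ} (i : ℕ) (hi : i < m) (hr : m + n = r + 1)
    (hd : a + b = c) (x : (CLInf K).obj m a) (y : (CLInf K).obj n b) :
    addInput ((CLInf K).comp i hi hr hd x y) =
      (CLInf K).comp (i + 1) (by omega) (show m + 1 + n = r + 1 + 1 by omega) hd (addInput x) y +
        (CLInf K).act (slotCycle (r + 1) i)
          ((CLInf K).comp i hi (show m + (n + 1) = r + 1 + 1 by omega) hd x (addInput y)) := by
  refine (congrArg Prod.snd (addInputLift.map_comp i hi hr hd x y)).trans ?_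
  change koszulSign K (0 * b) • (CLInf K).comp (i + 1) _ _ _ _ (addInputLift.map n b y).1 +
    (CLInf K).act _ ((CLInf K).comp i hi _ _ (addInputLift.map m a x).1 _) = _
  rw [addInputLift_fst, addInputLift_fst, zero_mul, koszulSign_zero, one_smul]
  rfl

/-- The two added inputs are interchangeable. On generators this is the symmetry of ℓ_{n+2}. On a
composite, the exchange swaps the two terms in which each factor gets one new input, and fixes the
other two by induction. -/
theorem act_addInput_addInput {n : ℕ} {k : ℤ} (x : (CLInf K).obj n k) :
    (CLInf K).act (slotCycle (n + 2) 1) (addInput (addInput x)) = addInput (addInput x) := by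
  induction x using CLInf.induction with
  | ell n => exact act_ell _
  | one => simp [addInput_one]
  | zero => simp
  | add x y hx hy => simp [hx, hy]
  | smul t x hx => simp [hx]
  | act σ x hx =>
    rename_i n k
    rw [addInput_act, addInput_act, ← GrOperad.act_mul,
      extendPerm_extendPerm_mul_slotCycle, GrOperad.act_mul, hx]
  | comp i hi hr hd x y hx hy =>
    rename_i m n r a b c
    have h1 := (CLInf K).comp_act_left (r := r + 2) (c := c) (i + 2) (i + 2) (by omega) (by omega)
      (by omega) (by omega) (slotCycle (m + 2) 1) (slotCycle (r + 2) 1)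
      (by rw [slotCycle_val (by omega)]; simp)
      (isBlockPerm_slotCycle_gt 1 (i + 2) (by omega) (by omega) (by omega))
      (addInput (addInput x)) y
    have h2 := (CLInf K).comp_act_right (r := r + 2) (c := c) i (by omega) (by omega) (by omega)
      (slotCycle (n + 2) 1) _
      (isBlockPerm_slotCycle_inner i 1 hi (by omega) (by omega)) x (addInput (addInput y))
    rw [hx] at h1
    rw [hy] at h2
    -- When both new inputs lie in `y`, `h2` gives the exchange only as a permutation at position
    -- `i`; applying the cycles that bring these inputs to the front turns it into the exchange of
    -- the first two.
    have h3 := congrArg ((CLInf K).act (slotCycle (r + 2) i * extendPerm (slotCycle (r + 1) i))) h2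
    rw [← GrOperad.act_mul, ← mul_assoc, inv_mul_cancel_right, ← slotCycle_mul_slotCycle_succ
      (by omega), ← extendPerm_slotCycle_mul (by omega)] at h3
    simp only [addInput_comp, map_add, addInput_act, ← GrOperad.act_mul]
    rw [slotCycle_succ_mul (by omega), extendPerm_slotCycle_mul (by omega), ← h1, h3, mul_assoc]
    abel

end addInput
end CLInf

/-! ### Unshuffles and the recursion for the quadratic expression. -/

theorem mem_unshuffles_iff {q n : ℕ} {σ : Equiv.Perm (Fin n)} :
    σ ∈ unshuffles q n ↔
      ∀ a b : Fin n, σ a < σ b → ((σ b : ℕ) < q ∨ q ≤ (σ a : ℕ)) → a < b := by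
  simp only [unshuffles, Finset.mem_filter, Finset.mem_univ, true_and]
  constructor
  · intro h a b hab hq
    simpa using h _ _ hab hq
  · intro h s t hst hq
    exact h _ _ (by simpa using hst) (by simpa using hq)

theorem extendPerm_mem_unshuffles {q n : ℕ} {σ : Equiv.Perm (Fin n)} :
    extendPerm σ ∈ unshuffles (q + 1) (n + 1) ↔ σ ∈ unshuffles q n := by
  rw [mem_unshuffles_iff, mem_unshuffles_iff]
  constructor
  · intro h a b hab hq
    have := h a.succ b.succ (by simpa using hab) (by simp only [extendPerm_succ, Fin.val_succ]; omega)
    simpa using this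
  · intro h a b
    refine Fin.cases ?_ (fun a => ?_) a <;> refine Fin.cases ?_ (fun b => ?_) b
    · simp
    · simp
    · simp
    · intro hab hq
      simp only [extendPerm_succ, Fin.val_succ, Fin.succ_lt_succ_iff] at *
      exact h a b hab (by omega)

theorem slotCycle_mul_extendPerm_mem_unshuffles {q n : ℕ} (hq : q < n + 1)
    {σ : Equiv.Perm (Fin n)} :
    slotCycle (n + 1) q * extendPerm σ ∈ unshuffles q (n + 1) ↔ σ ∈ unshuffles q n := by
  have h0 : ((slotCycle (n + 1) q * extendPerm σ) 0 : ℕ) = q := by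
    rw [Equiv.Perm.mul_apply, extendPerm_zero, slotCycle_val hq]
    simp
  have hs (a : Fin n) : ((slotCycle (n + 1) q * extendPerm σ) a.succ : ℕ) =
      if (σ a : ℕ) < q then (σ a : ℕ) else σ a + 1 := by
    rw [Equiv.Perm.mul_apply, extendPerm_succ, slotCycle_val hq]
    simp
  rw [mem_unshuffles_iff, mem_unshuffles_iff]
  simp only [Fin.lt_def]
  constructor
  · intro h a b hab hq
    have := h a.succ b.succ (by rw [hs, hs]; split_ifs <;> omega)
      (by rw [hs, hs]; split_ifs <;> omega)
    simpa using this
  · intro h a b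
    refine Fin.cases ?_ (fun a => ?_) a <;> refine Fin.cases ?_ (fun b => ?_) b
    · simp
    · simp
    · rw [h0]
      omega
    · rw [hs, hs]
      intro hab hq
      have := h a b (by split_ifs at * <;> omega) (by split_ifs at * <;> omega)
      simpa using this

/-- An unshuffle keeps the order within each block, so the smallest input goes to the first place of
its block. -/
theorem apply_zero_of_mem_unshuffles {q n : ℕ} {σ : Equiv.Perm (Fin (n + 1))}
    (h : σ ∈ unshuffles q (n + 1)) : (σ 0 : ℕ) = if (σ 0 : ℕ) < q then 0 else q := by
  rw [mem_unshuffles_iff] at h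
  have key (s : Fin (n + 1)) (hs : s < σ 0) (hq : (σ 0 : ℕ) < q ∨ q ≤ (s : ℕ)) : False := by
    have := h (σ⁻¹ s) 0 (by simpa using hs) (by simpa using hq)
    simp at this
  have := (σ 0).2
  split_ifs with hq
  · by_contra hne
    exact key ⟨0, by omega⟩ (by rw [Fin.lt_def]; simp only; omega) (Or.inl hq)
  · by_contra hne
    exact key ⟨q, by omega⟩ (by rw [Fin.lt_def]; simp; omega) (Or.inr le_rfl)

namespace CLInf
variable {K : Type u} [Field K]

/-- The sum of the unshuffles of `ℓ p ∘₁ ℓ q` satisfying a condition. -/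
noncomputable def unshuffleSum (K : Type u) [Field K] (n p q : ℕ) (h : p + q = n)
    (S : Finset (Equiv.Perm (Fin n))) :
    (CLInf K).obj n (-1 - 1) :=
  ∑ σ ∈ S, (CLInf K).act σ ((CLInf K).comp 0 p.succ_pos
    (show p + 1 + q = n + 1 by omega) (show (-1 : ℤ) + -1 = -1 - 1 by norm_num)
    (ell K (p + 1)) (ell K q))

/-- By the Leibniz rule the new input joins either ℓ_q or ℓ_{p+1}. Removing input 0 identifies the
unshuffles of n+1 inputs that send it to the chosen block with the unshuffles of n inputs: they are
`extendPerm σ` in the first case and `slotCycle (n + 1) q * extendPerm σ` in the second. -/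
theorem addInput_unshuffleSum (n p q : ℕ) (h : p + q = n) :
    addInput (unshuffleSum K n p q h (unshuffles q n)) =
      unshuffleSum K (n + 1) p (q + 1) (by omega)
        ((unshuffles (q + 1) (n + 1)).filter fun σ => (σ 0 : ℕ) < q + 1) +
      unshuffleSum K (n + 1) (p + 1) q (by omega)
        ((unshuffles q (n + 1)).filter fun σ => ¬ (σ 0 : ℕ) < q) := by
  have h1 : unshuffleSum K (n + 1) p (q + 1) (by omega)
      ((unshuffles (q + 1) (n + 1)).filter fun σ => (σ 0 : ℕ) < q + 1) =
      unshuffleSum K (n + 1) p (q + 1) (by omega) ((unshuffles q n).image extendPerm) := by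
    congr 1
    ext σ
    simp only [Finset.mem_filter, Finset.mem_image]
    constructor
    · rintro ⟨hσ, hq⟩
      have h0 := apply_zero_of_mem_unshuffles hσ
      rw [if_pos hq] at h0
      obtain ⟨τ, rfl⟩ := exists_extendPerm_eq σ (Fin.ext h0)
      exact ⟨τ, extendPerm_mem_unshuffles.1 hσ, rfl⟩
    · rintro ⟨τ, hτ, rfl⟩
      exact ⟨extendPerm_mem_unshuffles.2 hτ, by simp⟩
  have h2 : unshuffleSum K (n + 1) (p + 1) q (by omega)
      ((unshuffles q (n + 1)).filter fun σ => ¬ (σ 0 : ℕ) < q) =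
      unshuffleSum K (n + 1) (p + 1) q (by omega)
        ((unshuffles q n).image fun σ => slotCycle (n + 1) q * extendPerm σ) := by
    congr 1
    ext σ
    simp only [Finset.mem_filter, Finset.mem_image]
    constructor
    · rintro ⟨hσ, hq⟩
      have h0 := apply_zero_of_mem_unshuffles hσ
      rw [if_neg hq] at h0
      obtain ⟨τ, hτ⟩ := exists_slotCycle_mul_extendPerm_eq σ
      rw [h0] at hτ
      rw [hτ, slotCycle_mul_extendPerm_mem_unshuffles (by omega)] at hσ
      exact ⟨τ, hσ, hτ.symm⟩
    · rintro ⟨τ, hτ, rfl⟩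
      refine ⟨(slotCycle_mul_extendPerm_mem_unshuffles (by omega)).2 hτ, ?_⟩
      rw [Equiv.Perm.mul_apply, extendPerm_zero, slotCycle_val (by omega)]
      simp
  rw [h1, h2, unshuffleSum, unshuffleSum, unshuffleSum, map_sum,
    Finset.sum_image fun _ _ _ _ e => extendPerm_injective e,
    Finset.sum_image fun _ _ _ _ e => extendPerm_injective (mul_left_cancel e),
    ← Finset.sum_add_distrib]
  refine Finset.sum_congr rfl fun σ _ => ?_
  rw [addInput_act, addInput_comp, addInput_ell, addInput_ell, slotCycle_zero, GrOperad.act_one,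
    (CLInf K).comp_one_slot (by omega) (by omega) _ _ _ (act_ell _), map_add,
    ← GrOperad.act_mul]
  exact add_comm _ _

theorem unshuffleSum_eq_add (n p q : ℕ) (h : p + q = n + 1) :
    unshuffleSum K (n + 1) p q h (unshuffles q (n + 1)) =
      unshuffleSum K (n + 1) p q h ((unshuffles q (n + 1)).filter fun σ => (σ 0 : ℕ) < q) +
      unshuffleSum K (n + 1) p q h ((unshuffles q (n + 1)).filter fun σ => ¬ (σ 0 : ℕ) < q) :=
  (Finset.sum_filter_add_sum_filter_not _ _ _).symm

theorem shuffleSum_eq (n : ℕ) (F : ℕ × ℕ → (CLInf K).obj n (-1 - 1))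
    (hF : ∀ p q h, F (p, q) = unshuffleSum K n p q h (unshuffles q n)) :
    shuffleSum (CLInf K) (ell K) n = ∑ pq ∈ Finset.HasAntidiagonal.antidiagonal n, F pq := by
  rw [← Finset.sum_attach]
  refine Finset.sum_congr rfl fun pq _ => ?_
  exact (hF _ _ (Finset.HasAntidiagonal.mem_antidiagonal.mp pq.2)).symm

theorem shuffleSum_succ (n : ℕ) :
    shuffleSum (CLInf K) (ell K) (n + 1) = addInput (shuffleSum (CLInf K) (ell K) n) := by
  let A : ℕ × ℕ → (CLInf K).obj (n + 1) (-1 - 1) := fun pq =>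
    if h : pq.1 + pq.2 = n + 1 then unshuffleSum K (n + 1) pq.1 pq.2 h
      ((unshuffles pq.2 (n + 1)).filter fun σ => (σ 0 : ℕ) < pq.2) else 0
  let B : ℕ × ℕ → (CLInf K).obj (n + 1) (-1 - 1) := fun pq =>
    if h : pq.1 + pq.2 = n + 1 then unshuffleSum K (n + 1) pq.1 pq.2 h
      ((unshuffles pq.2 (n + 1)).filter fun σ => ¬ (σ 0 : ℕ) < pq.2) else 0
  rw [shuffleSum_eq (n + 1) (fun pq => A pq + B pq) (fun p q h => by
      simp only [A, B, dif_pos h, unshuffleSum_eq_add]),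
    shuffleSum_eq n (fun pq => if h : pq.1 + pq.2 = n then
      unshuffleSum K n pq.1 pq.2 h (unshuffles pq.2 n) else 0) (fun p q h => dif_pos h),
    Finset.sum_add_distrib, Finset.Nat.sum_antidiagonal_succ', Finset.Nat.sum_antidiagonal_succ (f := B),
    map_sum]
  -- The antidiagonal of n+1 has one more element than that of n. The extra terms vanish because
  -- input 0 cannot go to an empty block.
  have hA : A (n + 1, 0) = 0 := by simp [A, unshuffleSum]
  have hB : B (0, n + 1) = 0 := by
    simp only [B, zero_add, dif_pos]
    rw [Finset.filter_false_of_mem (by intro σ _; have := (σ 0).2; omega)]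
    rfl
  rw [hA, hB, zero_add, zero_add, ← Finset.sum_add_distrib]
  refine Finset.sum_congr rfl fun pq hpq => ?_
  have h := Finset.HasAntidiagonal.mem_antidiagonal.mp hpq
  rw [dif_pos h, addInput_unshuffleSum]
  simp only [A, B]
  rw [dif_pos (by omega), dif_pos (by omega)]

theorem shuffleSum_zero :
    shuffleSum (CLInf K) (ell K) 0 =
      (CLInf K).comp 0 Nat.one_pos (show 1 + 0 = 0 + 1 by rfl)
        (show (-1 : ℤ) + -1 = -1 - 1 by norm_num) (ell K 1) (ell K 0) := by
  rw [shuffleSum_eq 0 (fun _ => (CLInf K).comp 0 Nat.one_pos (show 1 + 0 = 0 + 1 by rfl)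
        (show (-1 : ℤ) + -1 = -1 - 1 by norm_num) (ell K 1) (ell K 0))]
  · simp
  · intro p q h
    obtain rfl : p = 0 := by omega
    obtain rfl : q = 0 := by omega
    rw [unshuffleSum, show unshuffles 0 0 = {1} by decide]
    simp [GrOperad.act_one]

/-- For n ≥ 2 the expression is a double `addInput`, hence unchanged by the exchange of the first
two inputs; equivariance of `addInput` and induction handle the permutations fixing the first input.
-/
theorem act_shuffleSum (n : ℕ) (σ : Equiv.Perm (Fin n)) :
    (CLInf K).act σ (shuffleSum (CLInf K) (ell K) n) = shuffleSum (CLInf K) (ell K) n := by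
  induction n with
  | zero => rw [Subsingleton.elim σ 1, GrOperad.act_one]
  | succ n ih =>
    cases n with
    | zero => rw [Subsingleton.elim (α := Equiv.Perm (Fin 1)) σ 1, GrOperad.act_one]
    | succ n =>
      refine GrOperad.act_eq_self_of_generators _ _ (fun σ => ?_) ?_ σ
      · rw [shuffleSum_succ (n + 1), ← addInput_act, ih]
      · rw [shuffleSum_succ, shuffleSum_succ, act_addInput_addInput]

end CLInf

/-! ### The differential and its square. -/

namespace CLInf
variable {K : Type u} [Field K]

section differential

theorem act_neg_shuffleSum (n : ℕ) (σ : Equiv.Perm (Fin n)) :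
    (CLInf K).act σ (-shuffleSum (CLInf K) (ell K) n) = -shuffleSum (CLInf K) (ell K) n := by
  rw [map_neg, act_shuffleSum]

/-- The differential of the curved `L∞` operad. -/
noncomputable def diff {n : ℕ} {k : ℤ} : (CLInf K).obj n k →ₗ[K] (CLInf K).obj n (k - 1) :=
  derivation _ act_neg_shuffleSum

theorem diff_ell (n : ℕ) : diff (ell K n) = -shuffleSum (CLInf K) (ell K) n := rfl

theorem diff_one : diff (CLInf K).one = 0 := derivation_one _ _

theorem diff_act {n : ℕ} {k : ℤ} (σ : Equiv.Perm (Fin n)) (x : (CLInf K).obj n k) :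
    diff ((CLInf K).act σ x) = (CLInf K).act σ (diff x) := derivation_act _ _ σ x

theorem diff_comp {m n r : ℕ} {a b c : ℤ} (i : ℕ) (hi : i < m) (hr : m + n = r + 1)
    (hd : a + b = c) (x : (CLInf K).obj m a) (y : (CLInf K).obj n b) :
    diff ((CLInf K).comp i hi hr hd x y) =
      (CLInf K).comp i hi hr (show (a - 1) + b = c - 1 by omega) (diff x) y +
        koszulSign K a •
          (CLInf K).comp i hi hr (show a + (b - 1) = c - 1 by omega) x (diff y) :=
  derivation_comp _ _ i hi hr hd x y

/-- Both sides obey the same Leibniz rule, as `addInput` has degree 0, and on generators the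
identity is `shuffleSum_succ`. -/
theorem diff_addInput {n : ℕ} {k : ℤ} (x : (CLInf K).obj n k) :
    diff (addInput x) = addInput (diff x) := by
  induction x using CLInf.induction with
  | ell n => rw [addInput_ell, diff_ell, diff_ell, shuffleSum_succ, map_neg]
  | one => rw [addInput_one, diff_one, map_zero, map_zero]
  | zero => simp
  | add x y hx hy => simp [hx, hy]
  | smul t x hx => simp [hx]
  | act σ x hx => simp only [addInput_act, diff_act, hx]
  | comp i hi hr hd x y hx hy =>
    simp only [addInput_comp, diff_comp, diff_act, map_add, map_smul, hx, hy, smul_add]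
    abel

/-- Parallel composition of the two odd elements ℓ_0 produces a minus sign, while the symmetry of
`x` identifies its first two inputs; so the composite equals its negative. -/
theorem comp_ell_zero_comp_ell_zero [CharZero K] {m : ℕ} {a b c : ℤ} (h1 : 1 < m + 2)
    (hr hr' hd hd') (x : (CLInf K).obj (m + 2) a)
    (hx : (CLInf K).act (slotCycle (m + 2) 1) x = x) :
    (CLInf K).comp (n := 0) (r := m) (b := -1) (c := c) 0 m.succ_pos hr' hd'
      ((CLInf K).comp (n := 0) (r := m + 1) (b := -1) (c := b) 0 (m + 1).succ_pos hr hd x (ell K 0))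
      (ell K 0) = 0 := by
  have h := (CLInf K).comp_comm (n := 0) (p := 0) 0 1 0 (by omega) (by omega) h1 rfl hr hr
    m.succ_pos m.succ_pos hr' hr' hd hd hd' hd' x (ell K 0) (ell K 0)
  rw [(CLInf K).comp_one_slot (by omega) h1 hr hd x hx, slotCycle_zero, GrOperad.act_one,
    show (-1 : ℤ) * -1 = 1 by rfl, koszulSign_one, neg_one_smul, eq_neg_iff_add_eq_zero,
    ← two_smul K] at h
  exact (smul_eq_zero_iff_right two_ne_zero).1 h

theorem diff_diff_ell [CharZero K] (n : ℕ) : diff (diff (ell K n)) = 0 := by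
  induction n with
  | zero =>
    have h1 := diff_ell (K := K) 1
    have h0 := diff_ell (K := K) 0
    rw [shuffleSum_succ, shuffleSum_zero, addInput_comp, addInput_ell, addInput_ell, slotCycle_zero,
      GrOperad.act_one, (CLInf K).comp_one_slot (by omega) (by omega) _ _ _ (act_ell _),
      slotCycle_zero, GrOperad.act_one] at h1
    rw [shuffleSum_zero] at h0
    rw [h0, map_neg, diff_comp, h1, h0, koszulSign_neg, koszulSign_one]
    simp only [map_neg, map_add, LinearMap.neg_apply, LinearMap.add_apply]
    rw [comp_ell_zero_comp_ell_zero (by omega) _ _ _ _ _ (act_ell _)]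
    -- The remaining terms (ℓ_1 ∘ ℓ_1) ∘ ℓ_0 and ℓ_1 ∘ (ℓ_1 ∘ ℓ_0) occur with opposite signs.
    have h2 := (CLInf K).comp_assoc (e := -1 - 1) (f := -1 - 1 - 1) (g := -1 - 1) (r := 1) (s := 0) (t := 0)
      0 0 (by omega) (by omega) (by omega) (by omega) (by omega)
      (by omega) (by omega) (by omega) (by omega) (by omega) (by omega) (ell K 1) (ell K 1)
      (ell K 0)
    rw [h2]
    simp
  | succ n ih =>
    rw [← addInput_ell, diff_addInput, diff_addInput, ih, map_zero]

theorem diff_diff [CharZero K] {n : ℕ} {k : ℤ} (x : (CLInf K).obj n k) : diff (diff x) = 0 := by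
  induction x using CLInf.induction with
  | ell n => exact diff_diff_ell n
  | one => rw [diff_one, map_zero]
  | zero => simp
  | add x y hx hy => simp [hx, hy]
  | smul t x hx => simp [hx]
  | act σ x hx => simp [diff_act, hx]
  | comp i hi hr hd x y hx hy =>
    simp only [diff_comp, map_add, map_smul, hx, hy, koszulSign_sub, koszulSign_one]
    simp

/-- The curved `L∞` operad as a dg operad. -/
noncomputable def dgStructure (K : Type u) [Field K] [CharZero K] : DGStructure (CLInf K) where
  d := diff
  d_act := diff_act
  d_comp := diff_comp
  d_d := diff_diff

end differential

/-! ### The suboperad without ℓ_0: stability, freeness over it, and ℓ_0 outside it. -/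

section base

theorem ell_mem_base {n : ℕ} (hn : 0 < n) : ell K n ∈ (base K).carrier n (-1) := by
  simp only [base, Suboperad.closure, Submodule.mem_iInf]
  exact fun S hS => hS _ _ (.ell n hn)

/-- This serves as the induction principle for the generated suboperad: a property is proved by
making it into a suboperad `S`. -/
theorem base_le (S : Suboperad (CLInf K)) (hS : ∀ n, 0 < n → ell K n ∈ S.carrier n (-1)) {n : ℕ}
    {k : ℤ} {x : (CLInf K).obj n k} (hx : x ∈ (base K).carrier n k) : x ∈ S.carrier n k := by
  simp only [base, Suboperad.closure, Submodule.mem_iInf] at hx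
  refine hx S ?_
  rintro n k x hx
  cases hx with
  | ell hn => exact hS _ hn

theorem addInput_mem_base {n : ℕ} {k : ℤ} {x : (CLInf K).obj n k}
    (hx : x ∈ (base K).carrier n k) : addInput x ∈ (base K).carrier (n + 1) k := by
  let S : Suboperad (CLInf K) :=
    { carrier := fun n k => (base K).carrier n k ⊓ ((base K).carrier (n + 1) k).comap addInput
      one_mem := ⟨(base K).one_mem, by simp [addInput_one]⟩
      act_mem := fun σ x hx => ⟨(base K).act_mem σ hx.1, by
        simpa [addInput_act] using (base K).act_mem _ hx.2⟩
      comp_mem := fun i hi hr hd x y hx hy => ⟨(base K).comp_mem i hi hr hd hx.1 hy.1, by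
        rw [SetLike.mem_coe, Submodule.mem_comap, addInput_comp]
        exact add_mem ((base K).comp_mem _ _ _ _ hx.2 hy.1)
          ((base K).act_mem _ ((base K).comp_mem _ _ _ _ hx.1 hy.2))⟩ }
  exact (base_le S (fun n hn => ⟨ell_mem_base hn, ell_mem_base n.succ_pos⟩) hx).2

/-- `ℓ (n + 1) ∘₁ ℓ 0`. -/
def curvatureTerm (K : Type u) [Field K] (n : ℕ) : (CLInf K).obj n (-1 - 1) :=
  (CLInf K).comp 0 n.succ_pos (show n + 1 + 0 = n + 1 by rfl)
    (show (-1 : ℤ) + -1 = -1 - 1 by norm_num) (ell K (n + 1)) (ell K 0)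

theorem addInput_curvatureTerm (n : ℕ) :
    addInput (curvatureTerm K n) = curvatureTerm K (n + 1) +
      (CLInf K).comp 0 n.succ_pos (show n + 1 + 1 = n + 1 + 1 by rfl)
        (show (-1 : ℤ) + -1 = -1 - 1 by norm_num) (ell K (n + 1)) (ell K 1) := by
  rw [curvatureTerm, addInput_comp, addInput_ell, addInput_ell,
    (CLInf K).comp_one_slot (by omega) (by omega) _ _ _ (act_ell _), slotCycle_zero,
    GrOperad.act_one, GrOperad.act_one]
  rfl

theorem act_curvatureTerm {n : ℕ} (σ : Equiv.Perm (Fin n)) :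
    (CLInf K).act σ (curvatureTerm K n) = curvatureTerm K n := by
  rw [curvatureTerm, ← (CLInf K).comp_act_left 0 0 n.succ_pos n.succ_pos _ _ (extendPerm σ) σ
    (by simp) (isBlockPerm_nullary σ _), act_ell]

/-- The term removed is the one with q = 0, the only one in dℓ_n that contains ℓ_0 when n > 0.
Instead of isolating it in the sum, apply `addInput` to the previous case: the Leibniz rule on
ℓ_{n+1} ∘ ℓ_0 gives ℓ_{n+2} ∘ ℓ_0 and the harmless ℓ_{n+1} ∘ ℓ_1. The induction starts from n = 0,
where the sum is zero. -/
theorem diff_ell_add_curvatureTerm_mem_base {n : ℕ} (hn : 0 < n) :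
    diff (ell K n) + curvatureTerm K n ∈ (base K).carrier n (-1 - 1) := by
  have h0 : diff (ell K 0) = -curvatureTerm K 0 := by
    rw [diff_ell, shuffleSum_zero]
    rfl
  have key (n : ℕ) : diff (ell K (n + 1)) + curvatureTerm K (n + 1) =
      addInput (diff (ell K n) + curvatureTerm K n) - (CLInf K).comp 0 n.succ_pos
        (show n + 1 + 1 = n + 1 + 1 by rfl)
        (show (-1 : ℤ) + -1 = -1 - 1 by norm_num) (ell K (n + 1)) (ell K 1) := by
    rw [map_add, addInput_curvatureTerm, ← addInput_ell, diff_addInput]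
    abel
  have hm (n : ℕ) := (base K).comp_mem 0 n.succ_pos (show n + 1 + 1 = n + 1 + 1 by rfl)
    (show (-1 : ℤ) + -1 = -1 - 1 by norm_num) (ell_mem_base n.succ_pos) (ell_mem_base Nat.one_pos)
  induction n with
  | zero => omega
  | succ n ih =>
    rw [key]
    refine sub_mem ?_ (hm n)
    obtain rfl | hn := n.eq_zero_or_pos
    · rw [h0, neg_add_cancel, map_zero]
      exact zero_mem _
    · exact addInput_mem_base (ih hn)

theorem isFreelyExtendedBy_base : IsFreelyExtendedBy (CLInf K) (base K) (ell K 0) := by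
  intro P f p
  -- The generators are split between the two data: ℓ_0 goes to `p` and the others follow `f`.
  let ν : ∀ n, P.obj n (-1)
    | 0 => p
    | n + 1 => f.map (n + 1) (-1) ⟨ell K (n + 1), ell_mem_base n.succ_pos⟩
  have hν : ∀ n σ, P.act σ (ν n) = ν n
    | 0, σ => by rw [Subsingleton.elim σ 1, GrOperad.act_one]
    | n + 1, σ => by
      refine (f.map_act σ _).symm.trans (congrArg (f.map (n + 1) (-1)) ?_)
      exact Subtype.ext (act_ell σ)
  have hf : ∀ (n : ℕ) (k : ℤ) (x : (base K).carrier n k), (lift ν hν).map n k x = f.map n k x := by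
    let S : Suboperad (CLInf K) :=
      { carrier := fun n k =>
          -- Membership is part of the condition because `f` is defined only on the suboperad.
          { carrier := {x | ∃ h : x ∈ (base K).carrier n k, (lift ν hν).map n k x = f.map n k ⟨x, h⟩}
            zero_mem' := ⟨zero_mem _, by
              rw [map_zero]; exact (map_zero (f.map n k)).symm⟩
            add_mem' := by
              rintro x y ⟨hx, hx'⟩ ⟨hy, hy'⟩
              exact ⟨add_mem hx hy, by
                rw [map_add, hx', hy']; exact (map_add (f.map n k) ⟨x, hx⟩ ⟨y, hy⟩).symm⟩
            smul_mem' := by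
              rintro t x ⟨hx, hx'⟩
              exact ⟨Submodule.smul_mem _ t hx, by
                rw [map_smul, hx']; exact (map_smul (f.map n k) t ⟨x, hx⟩).symm⟩ }
        one_mem := ⟨(base K).one_mem, (GrOperad.Hom.map_one _).trans f.map_one.symm⟩
        act_mem := by
          rintro n k σ x ⟨hx, hx'⟩
          exact ⟨(base K).act_mem σ hx, by
            rw [GrOperad.Hom.map_act, hx']; exact (f.map_act σ ⟨x, hx⟩).symm⟩
        comp_mem := by
          rintro m n r a b c i hi hr hd x y ⟨hx, hx'⟩ ⟨hy, hy'⟩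
          exact ⟨(base K).comp_mem i hi hr hd hx hy, by
            rw [GrOperad.Hom.map_comp, hx', hy']
            exact (f.map_comp i hi hr hd ⟨x, hx⟩ ⟨y, hy⟩).symm⟩ }
    rintro n k ⟨x, hx⟩
    obtain ⟨_, h⟩ := base_le S (fun n hn => ⟨ell_mem_base hn, by
      obtain _ | n := n
      · omega
      · rfl⟩) hx
    exact h
  refine ⟨lift ν hν, ⟨hf, rfl⟩, ?_⟩
  rintro g ⟨hg, hg0⟩
  refine hom_ext fun n => ?_
  obtain _ | n := n
  · exact hg0
  · exact hg _ _ ⟨_, ell_mem_base n.succ_pos⟩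

/-- Send ℓ_0 to `e` in the square-zero part of `pointExt` and all other generators to zero. The
operations with vanishing second component form a suboperad that contains every ℓ_n with n > 0, so
ℓ_0 could belong to it only if `e = 0`. Any operad with a nonzero identity then gives a
contradiction. -/
theorem eq_zero_of_ell_zero_mem_base (R : GrOperad K) (e : R.obj 1 0)
    (h : ell K 0 ∈ (base K).carrier 0 (-1)) : e = 0 := by
  let P := R.pointExt 1 (fun k => k + 1) (fun _ => rfl)
  let ν : ∀ n, P.obj n (-1)
    | 0 => ((0, e) : R.obj 0 (-1) × R.obj 1 0)
    | _ + 1 => 0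
  have hν : ∀ n σ, P.act σ (ν n) = ν n
    | 0, σ => by rw [Subsingleton.elim σ 1, GrOperad.act_one]
    | n + 1, σ => map_zero _
  let S : Suboperad (CLInf K) :=
    { carrier := fun n k => ((LinearMap.snd K (R.obj n k) (R.obj (n + 1) (k + 1))).comp
        ((lift ν hν).map n k)).ker
      one_mem := congrArg Prod.snd (lift ν hν).map_one
      act_mem := by
        intro n k σ x hx
        have hx' : ((lift ν hν).map n k x).2 = 0 := hx
        refine (congrArg Prod.snd ((lift ν hν).map_act σ x)).trans ?_
        exact (congrArg (R.act (extendPerm σ)) hx').trans (map_zero _)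
      comp_mem := by
        intro m n r a b c i hi hr hd x y hx hy
        have hx' : ((lift ν hν).map m a x).2 = 0 := hx
        have hy' : ((lift ν hν).map n b y).2 = 0 := hy
        refine (congrArg Prod.snd ((lift ν hν).map_comp i hi hr hd x y)).trans ?_
        change koszulSign K _ • R.comp _ _ _ _ ((lift ν hν).map m a x).2 _ +
          R.act _ (R.comp _ _ _ _ _ ((lift ν hν).map n b y).2) = 0
        rw [hx', hy']
        simp }
  refine base_le S (fun n hn => ?_) h
  obtain _ | n := n
  · omega
  · rfl

theorem ell_zero_notMem_base : ell K 0 ∉ (base K).carrier 0 (-1) := fun h =>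
  one_ne_zero (α := K) (congrArg Subtype.val
    (eq_zero_of_ell_zero_mem_base (GrOperad.commutative K) (GrOperad.commutative K).one h))

end base
end CLInf

/-! ### Splitting the differential of the free operad by weight. -/

section weight
variable {K : Type u} [Field K] {Q : GrOperad K} {S : Suboperad Q} {κ : Q.obj 0 (-1)}

theorem HasWeight.neg {w n : ℕ} {k : ℤ} {x : Q.obj n k} (h : HasWeight S κ w x) :
    HasWeight S κ w (-x) := by
  simpa using h.smul (-1)

theorem HasWeight.comp_of_eq {u v w m n r : ℕ} {a b c : ℤ} (i : ℕ) (hi : i < m) (hr : m + n = r + 1)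
    (hd : a + b = c) {x : Q.obj m a} {y : Q.obj n b} (hx : HasWeight S κ v x)
    (hy : HasWeight S κ w y) (h : v + w = u) : HasWeight S κ u (Q.comp i hi hr hd x y) :=
  h ▸ hx.comp i hi hr hd hy

end weight

namespace CLInf
variable {K : Type u} [Field K]

theorem act_kappaValue (n : ℕ) (σ : Equiv.Perm (Fin n)) :
    (CLInf K).act σ (if n = 0 then 0 else -curvatureTerm K n) =
      if n = 0 then 0 else -curvatureTerm K n := by
  split_ifs
  · exact map_zero _
  · rw [map_neg, act_curvatureTerm]

/-- The part of the differential that raises the number of `ℓ 0` by one. -/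
def diffKappa {n : ℕ} {k : ℤ} : (CLInf K).obj n k →ₗ[K] (CLInf K).obj n (k - 1) :=
  derivation _ act_kappaValue

theorem diffKappa_ell {n : ℕ} (hn : 0 < n) : diffKappa (ell K n) = -curvatureTerm K n :=
  if_neg hn.ne'

theorem diffKappa_ell_zero : diffKappa (ell K 0) = 0 := by
  rw [diffKappa, derivation_ell, if_pos rfl]

/-- The part of the differential that preserves the number of `ℓ 0`. -/
noncomputable def diffZero {n : ℕ} {k : ℤ} : (CLInf K).obj n k →ₗ[K] (CLInf K).obj n (k - 1) :=
  diff - diffKappa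

theorem diffZero_act {n : ℕ} {k : ℤ} (σ : Equiv.Perm (Fin n)) (x : (CLInf K).obj n k) :
    diffZero ((CLInf K).act σ x) = (CLInf K).act σ (diffZero x) := by
  simp only [diffZero, LinearMap.sub_apply, diff_act, map_sub]
  rw [diffKappa, derivation_act]

theorem diffZero_one : diffZero (CLInf K).one = 0 := by
  rw [diffZero, LinearMap.sub_apply, diff_one, diffKappa, derivation_one, sub_zero]

theorem diffZero_comp {m n r : ℕ} {a b c : ℤ} (i : ℕ) (hi : i < m) (hr : m + n = r + 1)
    (hd : a + b = c) (x : (CLInf K).obj m a) (y : (CLInf K).obj n b) :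
    diffZero ((CLInf K).comp i hi hr hd x y) =
      (CLInf K).comp i hi hr (show (a - 1) + b = c - 1 by omega) (diffZero x) y +
        koszulSign K a •
          (CLInf K).comp i hi hr (show a + (b - 1) = c - 1 by omega) x (diffZero y) := by
  simp only [diffZero, LinearMap.sub_apply, diff_comp, map_sub, smul_sub]
  rw [diffKappa, derivation_comp]
  abel

/-- Since `diffZero` is a derivation, it suffices to look at ℓ_n with n > 0, where subtracting
`diffKappa` removes exactly the term containing ℓ_0. -/
theorem diffZero_mem_base {n : ℕ} {k : ℤ} {x : (CLInf K).obj n k}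
    (hx : x ∈ (base K).carrier n k) : diffZero x ∈ (base K).carrier n (k - 1) := by
  let S : Suboperad (CLInf K) :=
    { carrier := fun n k => (base K).carrier n k ⊓ ((base K).carrier n (k - 1)).comap diffZero
      one_mem := ⟨(base K).one_mem, by
        rw [SetLike.mem_coe, Submodule.mem_comap, diffZero_one]
        exact zero_mem _⟩
      act_mem := fun σ x hx => ⟨(base K).act_mem σ hx.1, by
        rw [SetLike.mem_coe, Submodule.mem_comap, diffZero_act]
        exact (base K).act_mem _ hx.2⟩
      comp_mem := fun i hi hr hd x y hx hy => ⟨(base K).comp_mem i hi hr hd hx.1 hy.1, by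
        rw [SetLike.mem_coe, Submodule.mem_comap, diffZero_comp]
        exact add_mem ((base K).comp_mem _ _ _ _ hx.2 hy.1)
          (Submodule.smul_mem _ _ ((base K).comp_mem _ _ _ _ hx.1 hy.2))⟩ }
  refine (base_le S (fun n hn => ⟨ell_mem_base hn, ?_⟩) hx).2
  rw [SetLike.mem_coe, Submodule.mem_comap, diffZero, LinearMap.sub_apply, diffKappa_ell hn,
    sub_neg_eq_add]
  exact diff_ell_add_curvatureTerm_mem_base hn

theorem hasWeight_diffKappa_of_mem_base {n : ℕ} {k : ℤ} {x : (CLInf K).obj n k}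
    (hx : x ∈ (base K).carrier n k) : HasWeight (base K) (ell K 0) 1 (diffKappa x) := by
  let S : Suboperad (CLInf K) :=
    { carrier := fun n k => (base K).carrier n k ⊓
        { carrier := {x | HasWeight (base K) (ell K 0) 1 (diffKappa x)}
          zero_mem' := by
            rw [Set.mem_ofPred_eq, map_zero]
            exact .zero _ _ _
          add_mem' := fun {x y} hx hy => by
            rw [Set.mem_ofPred_eq, map_add]
            exact .add hx hy
          smul_mem' := fun t x hx => by
            rw [Set.mem_ofPred_eq, map_smul]
            exact .smul t hx }
      one_mem := ⟨(base K).one_mem, by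
        change HasWeight _ _ _ (diffKappa _)
        rw [diffKappa, derivation_one]
        exact .zero _ _ _⟩
      act_mem := fun σ x hx => ⟨(base K).act_mem σ hx.1, by
        change HasWeight _ _ _ (diffKappa _)
        rw [diffKappa, derivation_act]
        exact .act _ hx.2⟩
      comp_mem := fun i hi hr hd x y hx hy => ⟨(base K).comp_mem i hi hr hd hx.1 hy.1, by
        change HasWeight _ _ _ (diffKappa _)
        rw [diffKappa, derivation_comp]
        exact .add (.comp_of_eq _ _ _ _ hx.2 (.of_mem hy.1) rfl)
          (.smul _ (.comp_of_eq _ _ _ _ (.of_mem hx.1) hy.2 rfl))⟩ }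
  refine (base_le S (fun n hn => ⟨ell_mem_base hn, ?_⟩) hx).2
  change HasWeight _ _ _ (diffKappa _)
  rw [diffKappa_ell hn]
  exact (HasWeight.comp_of_eq _ _ _ _ (.of_mem (ell_mem_base n.succ_pos)) .kappa rfl).neg

theorem hasWeight_diffKappa {w n : ℕ} {k : ℤ} {x : (CLInf K).obj n k}
    (hx : HasWeight (base K) (ell K 0) w x) :
    HasWeight (base K) (ell K 0) (w + 1) (diffKappa x) := by
  induction hx with
  | of_mem h => exact hasWeight_diffKappa_of_mem_base h
  | kappa =>
    rw [diffKappa_ell_zero]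
    exact .zero _ _ _
  | zero =>
    rw [map_zero]
    exact .zero _ _ _
  | add _ _ hx hy =>
    rw [map_add]
    exact .add hx hy
  | smul t _ hx =>
    rw [map_smul]
    exact .smul t hx
  | act σ _ hx =>
    rw [diffKappa, derivation_act]
    exact .act σ hx
  | comp i hi hr hd hx hy hx' hy' =>
    rw [diffKappa, derivation_comp]
    exact .add (.comp_of_eq _ _ _ _ hx' hy (by omega))
      (.smul _ (.comp_of_eq _ _ _ _ hx hy' (by omega)))

theorem hasWeight_diffZero {w n : ℕ} {k : ℤ} {x : (CLInf K).obj n k}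
    (hx : HasWeight (base K) (ell K 0) w x) :
    HasWeight (base K) (ell K 0) w (diffZero x) := by
  induction hx with
  | of_mem h => exact .of_mem (diffZero_mem_base h)
  | kappa =>
    -- dℓ_0 = −ℓ_1 ∘ ℓ_0 still contains ℓ_0 exactly once, so all of it belongs to the
    -- weight-preserving part.
    rw [diffZero, LinearMap.sub_apply, diffKappa_ell_zero, sub_zero, diff_ell, shuffleSum_zero]
    exact (HasWeight.comp_of_eq _ _ _ _ (.of_mem (ell_mem_base Nat.one_pos)) .kappa rfl).neg
  | zero =>
    rw [map_zero]
    exact .zero _ _ _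
  | add _ _ hx hy =>
    rw [map_add]
    exact .add hx hy
  | smul t _ hx =>
    rw [map_smul]
    exact .smul t hx
  | act σ _ hx =>
    rw [diffZero_act]
    exact .act σ hx
  | comp i hi hr hd hx hy hx' hy' =>
    rw [diffZero_comp]
    exact .add (.comp_of_eq _ _ _ _ hx' hy rfl) (.smul _ (.comp_of_eq _ _ _ _ hx hy' rfl))

/-- The curved `L∞` operad as an object of the category of curved operads. -/
noncomputable def curvStructure (K : Type u) [Field K] [CharZero K] : CurvStructure (CLInf K) where
  toDGStructure := dgStructure K
  κ := ell K 0
  base := base K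
  κ_notMem := ell_zero_notMem_base
  free := isFreelyExtendedBy_base
  mixed := ⟨diffZero, diffKappa, fun x => (sub_add_cancel (diff x) (diffKappa x)).symm,
    fun _ => hasWeight_diffZero, fun _ => hasWeight_diffKappa, diffKappa_ell_zero⟩

end CLInf

/-! ### Derivations and low weights in an operad freely extended by κ. -/

section
variable {K : Type u} [Field K]

namespace GrOperad

/-- Composing with an operation of arity `0` at any input reduces to composing at input `0`. -/
theorem comp_nullary (R : GrOperad K) {r : ℕ} {a b c : ℤ} (i : ℕ) (hi : i < r + 1)
    (hr : r + 1 + 0 = r + 1) (hd : a + b = c) (x : R.obj (r + 1) a) (y : R.obj 0 b) :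
    R.comp i hi hr hd x y = R.comp 0 r.succ_pos hr hd (R.act (slotCycle (r + 1) i) x) y := by
  rw [R.comp_act_left 0 i _ hi _ _ _ 1 (by rw [slotCycle_val hi]; simp)
    (isBlockPerm_slotCycle_nullary hi), R.act_one]

/-- A derivation adding a new first input to the operations, of degree `e`. -/
structure PointDerivation (Q : GrOperad K) (e : ℤ) where
  map : ∀ {n : ℕ} {k l : ℤ}, k + e = l → (Q.obj n k →ₗ[K] Q.obj (n + 1) l)
  map_one : ∀ {l : ℤ} (h : 0 + e = l), map h Q.one = 0
  map_act : ∀ {n : ℕ} {k l : ℤ} (h : k + e = l) (σ : Equiv.Perm (Fin n)) (x : Q.obj n k),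
    map h (Q.act σ x) = Q.act (extendPerm σ) (map h x)
  map_comp : ∀ {m n r : ℕ} {a b c a' b' c' : ℤ} (i : ℕ) (hi : i < m) (hr : m + n = r + 1)
    (hd : a + b = c) (ha : a + e = a') (hb : b + e = b') (hc : c + e = c')
    (x : Q.obj m a) (y : Q.obj n b),
    map hc (Q.comp i hi hr hd x y) =
      koszulSign K (e * b) • Q.comp (i + 1) (Nat.succ_lt_succ hi)
          (show m + 1 + n = r + 1 + 1 by omega) (show a' + b = c' by omega) (map ha x) y +
        Q.act (slotCycle (r + 1) i) (Q.comp i hi (show m + (n + 1) = r + 1 + 1 by omega)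
          (show a + b' = c' by omega) x (map hb y))

variable {Q : GrOperad K}

/-- The uniqueness half of the universal property, applied to `g` and the identity. -/
theorem Hom.eq_id_of_isFreelyExtendedBy {B : Suboperad Q} {κ : Q.obj 0 (-1)}
    (hfree : IsFreelyExtendedBy Q B κ) (g : Q.Hom Q)
    (h : ∀ (n : ℕ) (k : ℤ) (x : B.carrier n k), g.map n k x = x) (hκ : g.map 0 (-1) κ = κ)
    {n : ℕ} {k : ℤ} (x : Q.obj n k) : g.map n k x = x := by
  let f : B.toGrOperad.Hom Q :=
    { map := fun n k => (B.carrier n k).subtype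
      map_one := rfl
      map_act := fun _ _ => rfl
      map_comp := fun _ _ _ _ _ _ => rfl }
  let i : Q.Hom Q :=
    { map := fun n k => LinearMap.id
      map_one := rfl
      map_act := fun _ _ => rfl
      map_comp := fun _ _ _ _ _ _ => rfl }
  have := (hfree Q f κ).unique (y₁ := g) (y₂ := i) ⟨h, hκ⟩ ⟨fun _ _ _ => rfl, rfl⟩
  rw [this]
  rfl

/-- A derivation on a suboperad extends to a free extension, with any value on the new generator. -/
theorem exists_pointDerivation {B : Suboperad Q} {κ : Q.obj 0 (-1)}
    (hfree : IsFreelyExtendedBy Q B κ) (e : ℤ)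
    (δ : ∀ {n : ℕ} {k : ℤ}, Q.obj n k →ₗ[K] Q.obj (n + 1) (k + e))
    (h_one : δ Q.one = 0)
    (h_act : ∀ {n : ℕ} {k : ℤ} (σ : Equiv.Perm (Fin n)) {x : Q.obj n k}, x ∈ B.carrier n k →
      δ (Q.act σ x) = Q.act (extendPerm σ) (δ x))
    (h_comp : ∀ {m n r : ℕ} {a b c : ℤ} (i : ℕ) (hi : i < m) (hr : m + n = r + 1)
      (hd : a + b = c) {x : Q.obj m a} {y : Q.obj n b}, x ∈ B.carrier m a → y ∈ B.carrier n b →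
      δ (Q.comp i hi hr hd x y) =
        koszulSign K (e * b) • Q.comp (i + 1) (Nat.succ_lt_succ hi)
            (show m + 1 + n = r + 1 + 1 by omega) (show a + e + b = c + e by omega) (δ x) y +
          Q.act (slotCycle (r + 1) i) (Q.comp i hi (show m + (n + 1) = r + 1 + 1 by omega)
            (show a + (b + e) = c + e by omega) x (δ y)))
    (p : Q.obj 1 (-1 + e)) :
    ∃ D : PointDerivation Q e, (∀ {n : ℕ} {k : ℤ} {x : Q.obj n k}, x ∈ B.carrier n k →
      D.map rfl x = δ x) ∧ D.map rfl κ = p := by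
  let P := Q.pointExt e (fun k => k + e) (fun _ => rfl)
  -- The graph of a derivation is a morphism to the square-zero extension; freeness extends it by
  -- sending κ to `(κ, p)`.
  let f : B.toGrOperad.Hom P :=
    { map := fun n k => (LinearMap.id.prod δ).comp (B.carrier n k).subtype
      map_one := Prod.ext rfl h_one
      map_act := fun σ x => Prod.ext rfl (h_act σ x.2)
      map_comp := fun i hi hr hd x y => Prod.ext rfl (h_comp i hi hr hd x.2 y.2) }
  obtain ⟨g, ⟨hg, hgκ⟩, -⟩ := hfree P f (κ, p)
  -- The second component of `g` obeys the Leibniz rule only once the first component is known to be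
  -- the identity.
  have hfst : ∀ {n : ℕ} {k : ℤ} (x : Q.obj n k), (g.map n k x).1 = x := by
    let g₁ : Q.Hom Q :=
      { map := fun n k => (LinearMap.fst K (Q.obj n k) (Q.obj (n + 1) (k + e))).comp (g.map n k)
        map_one := congrArg Prod.fst g.map_one
        map_act := fun σ x => congrArg Prod.fst (g.map_act σ x)
        map_comp := fun i hi hr hd x y => congrArg Prod.fst (g.map_comp i hi hr hd x y) }
    intro n k x
    exact g₁.eq_id_of_isFreelyExtendedBy hfree (fun n k x => congrArg Prod.fst (hg n k x))
      (congrArg Prod.fst hgκ) x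
  let D : PointDerivation Q e :=
    { map := fun {n k l} h => h ▸
        (LinearMap.snd K (Q.obj n k) (Q.obj (n + 1) (k + e))).comp (g.map n k)
      map_one := by
        rintro _ rfl
        exact congrArg Prod.snd g.map_one
      map_act := by
        rintro n k _ rfl σ x
        exact congrArg Prod.snd (g.map_act σ x)
      map_comp := by
        rintro m n r a b c _ _ _ i hi hr hd rfl rfl rfl x y
        refine (congrArg Prod.snd (g.map_comp i hi hr hd x y)).trans ?_
        change koszulSign K (e * b) • Q.comp (i + 1) _ _ _ _ (g.map n b y).1 +
          Q.act _ (Q.comp i hi _ _ (g.map m a x).1 _) = _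
        rw [hfst, hfst]
        rfl }
  exact ⟨D, fun {n k x} hx => congrArg Prod.snd (hg n k ⟨x, hx⟩), congrArg Prod.snd hgκ⟩

end GrOperad

section weight
variable {Q : GrOperad K} {B : Suboperad Q} {κ : Q.obj 0 (-1)}

/-- Operations of weight `0` belong to the suboperad, and those of weight `1` arise by composing
an operation of the suboperad with `κ`. -/
theorem HasWeight.exists_eq {w n : ℕ} {k : ℤ} {x : Q.obj n k} (h : HasWeight B κ w x) :
    (w = 0 → x ∈ B.carrier n k) ∧ (w = 1 → ∀ (l : ℤ) (hl : l + -1 = k),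
      ∃ y ∈ B.carrier (n + 1) l, x = Q.comp 0 n.succ_pos (Nat.add_zero (n + 1)) hl y κ) := by
  induction h with
  | of_mem h => exact ⟨fun _ => h, fun h => by omega⟩
  | kappa =>
    refine ⟨fun h => by omega, fun _ l hl => ?_⟩
    obtain rfl : l = 0 := by omega
    exact ⟨Q.one, B.one_mem, (Q.one_comp _ _ _ κ).symm⟩
  | zero => exact ⟨fun _ => zero_mem _, fun _ l hl => ⟨0, zero_mem _, by simp⟩⟩
  | add _ _ hx hy =>
    refine ⟨fun h => add_mem (hx.1 h) (hy.1 h), fun h l hl => ?_⟩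
    obtain ⟨x', hx', rfl⟩ := hx.2 h l hl
    obtain ⟨y', hy', rfl⟩ := hy.2 h l hl
    exact ⟨x' + y', add_mem hx' hy', by simp⟩
  | smul t _ hx =>
    refine ⟨fun h => Submodule.smul_mem _ t (hx.1 h), fun h l hl => ?_⟩
    obtain ⟨x', hx', rfl⟩ := hx.2 h l hl
    exact ⟨t • x', Submodule.smul_mem _ t hx', by simp⟩
  | act σ _ hx =>
    refine ⟨fun h => B.act_mem σ (hx.1 h), fun h l hl => ?_⟩
    obtain ⟨x', hx', rfl⟩ := hx.2 h l hl
    exact ⟨Q.act (extendPerm σ) x', B.act_mem _ hx',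
      (Q.comp_act_left 0 0 _ _ _ _ _ _ (by simp) (isBlockPerm_nullary σ _) x' κ).symm⟩
  | @comp v w m n r a b c i hi hr hd x y _ _ hx hy =>
    refine ⟨fun h => B.comp_mem i hi hr hd (hx.1 (by omega)) (hy.1 (by omega)), fun h l hl => ?_⟩
    -- The single κ lies in `y`, and is pulled out by sequential composition, or in `x`, and is
    -- pulled out past `y` by parallel composition at the cost of a sign.
    obtain ⟨hv, hw⟩ | ⟨hv, hw⟩ : v = 0 ∧ w = 1 ∨ v = 1 ∧ w = 0 := by omega
    · obtain ⟨y', hy', rfl⟩ := hy.2 hw (b + 1) (by omega)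
      refine ⟨Q.act (slotCycle (r + 1) i) (Q.comp i hi (show m + (n + 1) = r + 1 + 1 by omega)
        (show a + (b + 1) = l by omega) x y'), B.act_mem _ (B.comp_mem _ _ _ _ (hx.1 hv) hy'), ?_⟩
      rw [← Q.comp_nullary i (by omega)]
      exact (Q.comp_assoc i 0 hi n.succ_pos _ _ _ _ _ _ _ _ _ x y' κ).symm
    · obtain ⟨x', hx', rfl⟩ := hx.2 hv (a + 1) (by omega)
      refine ⟨koszulSign K (-1 * b) • Q.comp (i + 1) (by omega)
        (show m + 1 + n = r + 1 + 1 by omega) (show a + 1 + b = l by omega) x' y,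
        Submodule.smul_mem _ _ (B.comp_mem _ _ _ _ hx' (hy.1 hw)), ?_⟩
      rw [map_smul, LinearMap.smul_apply]
      exact Q.comp_comm 0 (i + 1) i (by omega) (by omega) (by omega) (by omega) _ _ hi _ _ _ _ _ _
        _ x' κ y

end weight

/-! ### The canonical elements ν_n of an object of the category. -/

section
variable {Q : GrOperad K}

/-- The Leibniz rule for 1 ∘ 1 = 1 gives d1 = d1 + d1. -/
theorem DGStructure.d_one (S : DGStructure Q) : S.d Q.one = 0 := by
  have h := S.d_comp 0 Nat.one_pos rfl (add_zero 0) Q.one Q.one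
  rw [Q.comp_one, Q.comp_one, koszulSign_zero, one_smul, Q.one_comp] at h
  simpa using h

namespace CurvStructure
variable (S : CurvStructure Q)

theorem exists_kappaDerivative : ∃ D : Q.PointDerivation 1,
    (∀ {n : ℕ} {k : ℤ} {x : Q.obj n k}, x ∈ S.base.carrier n k → D.map rfl x = 0) ∧
      D.map (neg_add_cancel 1) S.κ = Q.one :=
  GrOperad.exists_pointDerivation S.free 1 0 rfl (fun _ _ _ => (map_zero _).symm)
    (fun _ _ _ _ _ _ _ _ => by simp) Q.one

/-- The derivation replacing the occurrences of `κ`, one at a time, by a new first input. -/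
noncomputable def kappaDerivative : Q.PointDerivation 1 := S.exists_kappaDerivative.choose

theorem kappaDerivative_of_mem {n : ℕ} {k l : ℤ} (h : k + 1 = l) {x : Q.obj n k}
    (hx : x ∈ S.base.carrier n k) : S.kappaDerivative.map h x = 0 := by
  subst h
  exact S.exists_kappaDerivative.choose_spec.1 hx

theorem kappaDerivative_kappa : S.kappaDerivative.map (neg_add_cancel 1) S.κ = Q.one :=
  S.exists_kappaDerivative.choose_spec.2

theorem kappaDerivative_comp_kappa {n : ℕ} {a c : ℤ} (i : ℕ) (hi : i < n + 1) (hd : a + -1 = c)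
    (h : c + 1 = a) {x : Q.obj (n + 1) a} (hx : x ∈ S.base.carrier (n + 1) a) :
    S.kappaDerivative.map h (Q.comp i hi (Nat.add_zero (n + 1)) hd x S.κ) =
      Q.act (slotCycle (n + 1) i) x := by
  rw [S.kappaDerivative.map_comp i hi _ hd rfl (neg_add_cancel 1) h,
    S.kappaDerivative_of_mem rfl hx, S.kappaDerivative_kappa, Q.comp_one]
  simp

/-- For `x` in Q₀, d₀x lies in Q₀ and d₁x = y ∘₁ κ with y in Q₀. The derivative kills d₀x and
recovers y, so both parts can be read off from dx alone. -/
theorem d_mem {n : ℕ} {k : ℤ} (h : k - 1 + 1 = k) (hd : k + -1 = k - 1) {x : Q.obj n k}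
    (hx : x ∈ S.base.carrier n k) :
    S.kappaDerivative.map h (S.d x) ∈ S.base.carrier (n + 1) k ∧
      S.d x - Q.comp 0 n.succ_pos (Nat.add_zero (n + 1)) hd (S.kappaDerivative.map h (S.d x)) S.κ ∈
        S.base.carrier n (k - 1) := by
  obtain ⟨d₀, d₁, hs, h₀, h₁, -⟩ := S.mixed
  have hx₀ := (h₀ x (.of_mem hx)).exists_eq.1 rfl
  obtain ⟨y, hy, hxy⟩ := (h₁ x (.of_mem hx)).exists_eq.2 rfl k hd
  have : S.kappaDerivative.map h (S.d x) = y := by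
    rw [hs, map_add, S.kappaDerivative_of_mem h hx₀, hxy, S.kappaDerivative_comp_kappa 0 _ hd h hy,
      slotCycle_zero, Q.act_one, zero_add]
  rw [this, hs, ← hxy, add_sub_cancel_right]
  exact ⟨hy, hx₀⟩

/-- Because d₁κ = 0, all of dκ has weight one and hence comes from a unary operation of Q₀ composed
with κ. -/
theorem d_kappa (h : (-1 : ℤ) - 1 + 1 = -1) (hd : (-1 : ℤ) + -1 = -1 - 1) :
    S.kappaDerivative.map h (S.d S.κ) ∈ S.base.carrier 1 (-1) ∧
      S.d S.κ = Q.comp 0 Nat.one_pos (Nat.add_zero 1) hd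
        (S.kappaDerivative.map h (S.d S.κ)) S.κ := by
  obtain ⟨d₀, d₁, hs, h₀, h₁, hκ⟩ := S.mixed
  obtain ⟨y, hy, hxy⟩ := (h₀ S.κ .kappa).exists_eq.2 rfl (-1) hd
  have : S.kappaDerivative.map h (S.d S.κ) = y := by
    rw [hs, hκ, add_zero, hxy, S.kappaDerivative_comp_kappa 0 _ hd h hy, slotCycle_zero, Q.act_one]
  rw [this, hs, hκ, add_zero]
  exact ⟨hy, hxy⟩

/-- The images of the generators `ℓ n`. -/
noncomputable def generator : ∀ n : ℕ, Q.obj n (-1)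
  | 0 => S.κ
  | n + 1 => -S.kappaDerivative.map (sub_add_cancel (-1) 1) (S.d (generator n))

theorem generator_succ (n : ℕ) : S.generator (n + 1) =
    -S.kappaDerivative.map (sub_add_cancel (-1) 1) (S.d (S.generator n)) := rfl

theorem generator_succ_mem (n : ℕ) : S.generator (n + 1) ∈ S.base.carrier (n + 1) (-1) := by
  rw [generator]
  induction n with
  | zero => exact neg_mem (S.d_kappa _ rfl).1
  | succ n ih =>
    refine neg_mem (S.d_mem _ rfl ?_).1
    rw [generator]
    exact ih

/-- The part of the differential of `generator n` that does not involve `κ`. -/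
noncomputable def remainder (n : ℕ) : Q.obj n (-1 - 1) :=
  S.d (S.generator n) + Q.comp 0 n.succ_pos (Nat.add_zero (n + 1))
    (show (-1 : ℤ) + -1 = -1 - 1 from rfl) (S.generator (n + 1)) S.κ

theorem d_generator (n : ℕ) : S.d (S.generator n) = S.remainder n -
    Q.comp 0 n.succ_pos (Nat.add_zero (n + 1))
    (show (-1 : ℤ) + -1 = -1 - 1 from rfl) (S.generator (n + 1)) S.κ :=
  (add_sub_cancel_right _ _).symm

theorem remainder_zero : S.remainder 0 = 0 := by
  rw [remainder, generator, generator, map_neg, LinearMap.neg_apply, generator, add_neg_eq_zero]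
  exact (S.d_kappa _ rfl).2

theorem remainder_mem (n : ℕ) : S.remainder n ∈ S.base.carrier n (-1 - 1) := by
  obtain _ | n := n
  · rw [remainder_zero]
    exact zero_mem _
  · have := (S.d_mem (sub_add_cancel (-1) 1) rfl (S.generator_succ_mem n)).2
    rw [remainder, S.generator_succ (n + 1), map_neg, LinearMap.neg_apply, ← sub_eq_add_neg]
    exact this

/-- Differentiating once in κ leaves y + z ∘₁ κ − z ∘₂ κ = 0, since the two odd κ are removed with
opposite signs. Differentiating again leaves z minus its image under the exchange of the first two
inputs. With this symmetry the two composites in the first equation cancel, so y = 0. -/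
theorem eq_zero_of_add_comp_kappa {n : ℕ} {a b c : ℤ} (hb : a + -1 = b) (hc : b + -1 = c)
    {x : Q.obj n c} {y : Q.obj (n + 1) b} {z : Q.obj (n + 2) a}
    (hx : x ∈ S.base.carrier n c) (hy : y ∈ S.base.carrier (n + 1) b)
    (hz : z ∈ S.base.carrier (n + 2) a)
    (h : x + Q.comp 0 n.succ_pos (Nat.add_zero (n + 1)) hc y S.κ +
      Q.comp 0 n.succ_pos (Nat.add_zero (n + 1)) hc
        (Q.comp 0 (n + 1).succ_pos (Nat.add_zero (n + 2)) hb z S.κ) S.κ = 0) :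
    y = 0 ∧ Q.act (slotCycle (n + 2) 1) z = z := by
  have hc' : c + 1 = b := by omega
  have hb' : b + 1 = a := by omega
  have h1 := congrArg (S.kappaDerivative.map hc') h
  rw [map_add, map_add, S.kappaDerivative_of_mem hc' hx, S.kappaDerivative_comp_kappa 0 _ hc hc' hy,
    S.kappaDerivative.map_comp 0 _ _ hc hb' (neg_add_cancel 1) hc',
    S.kappaDerivative_comp_kappa 0 _ hb hb' hz, S.kappaDerivative_kappa, Q.comp_one,
    slotCycle_zero, slotCycle_zero, Q.act_one, Q.act_one, Q.act_one, map_zero, zero_add,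
    one_mul, koszulSign_neg, koszulSign_one, neg_one_smul] at h1
  have h2 := congrArg (S.kappaDerivative.map hb') h1
  rw [map_add, map_add, map_neg, S.kappaDerivative_of_mem hb' hy,
    S.kappaDerivative_comp_kappa _ _ hb hb' hz, S.kappaDerivative_comp_kappa _ _ hb hb' hz,
    slotCycle_zero, Q.act_one, map_zero, zero_add, neg_add_eq_zero] at h2
  refine ⟨?_, h2⟩
  rwa [Q.comp_one_slot (n + 1).succ_pos _ _ _ _ h2, slotCycle_zero, Q.act_one, neg_add_cancel,
    add_zero] at h1

/-- Expanding d²ν_n = 0 and collecting by the number of κ. With r_n for `remainder n`, the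
coefficient of one κ is D d r_n − r_{n+1} − ν_{n+1} ∘₁ ν_1, and that of two κ is ν_{n+2}. -/
theorem generator_relation (n : ℕ) :
    S.kappaDerivative.map (sub_add_cancel (-1 - 1) 1) (S.d (S.remainder n)) =
      S.remainder (n + 1) + Q.comp 0 n.succ_pos (show n + 1 + 1 = n + 1 + 1 from rfl)
        (show (-1 : ℤ) + -1 = -1 - 1 from rfl)
        (S.generator (n + 1)) (S.generator 1) ∧
    Q.act (slotCycle (n + 2) 1) (S.generator (n + 2)) = S.generator (n + 2) := by
  have hd := S.d_mem (sub_add_cancel (-1 - 1) 1) rfl (S.remainder_mem n)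
  have h0 : S.d S.κ = -Q.comp 0 Nat.one_pos (Nat.add_zero 1)
    (show (-1 : ℤ) + -1 = -1 - 1 from rfl) (S.generator 1) S.κ := by
    have := S.d_generator 0
    rwa [S.remainder_zero, zero_sub, generator] at this
  have hdd := S.d_d (S.generator n)
  rw [S.d_generator n, map_sub, S.d_comp, S.d_generator (n + 1), h0, koszulSign_neg, koszulSign_one,
    map_neg, neg_one_smul, neg_neg, map_sub, LinearMap.sub_apply] at hdd
  have ha := Q.comp_assoc (e := -1 - 1) (f := -1 - 1 - 1) (g := -1 - 1) (r := n + 1) (s := 0)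
    (t := n) 0 0 n.succ_pos Nat.one_pos rfl rfl n.succ_pos rfl rfl rfl rfl rfl rfl
    (S.generator (n + 1)) (S.generator 1) S.κ
  rw [← ha] at hdd
  have key := S.eq_zero_of_add_comp_kappa rfl rfl hd.2
    (sub_mem (sub_mem hd.1 (S.remainder_mem (n + 1)))
      (S.base.comp_mem 0 n.succ_pos (show n + 1 + 1 = n + 1 + 1 from rfl)
        (show (-1 : ℤ) + -1 = -1 - 1 from rfl)
        (S.generator_succ_mem n) (S.generator_succ_mem 0))) (S.generator_succ_mem (n + 1)) (by
    rw [← hdd, map_sub, map_sub, LinearMap.sub_apply, LinearMap.sub_apply]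
    abel)
  refine ⟨?_, key.2⟩
  rw [← sub_eq_zero, sub_add_eq_sub_sub]
  exact key.1

/-- Permutations fixing the first input are handled by induction, as D and d are equivariant; the
exchange of the first two inputs comes from the part of d² = 0 with two κ. -/
theorem act_generator : ∀ (n : ℕ) (σ : Equiv.Perm (Fin n)),
    Q.act σ (S.generator n) = S.generator n
  | 0, σ => by rw [Subsingleton.elim σ 1, Q.act_one]
  | 1, σ => by rw [Subsingleton.elim (α := Equiv.Perm (Fin 1)) σ 1, Q.act_one]
  | n + 2, σ => by
    refine Q.act_eq_self_of_generators _ (fun σ => ?_) (S.generator_relation n).2 σ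
    rw [generator, map_neg, ← S.kappaDerivative.map_act, ← S.d_act, act_generator (n + 1) σ]

/-- On Q₀ the derivative in κ vanishes, so D d satisfies a Leibniz rule there although it is a
composite of two derivations. The sign (−1)^k is needed because d is a derivation from the left and
D from the right. -/
theorem exists_addInput : ∃ D : Q.PointDerivation 0,
    (∀ {n : ℕ} {k : ℤ} {x : Q.obj n k}, x ∈ S.base.carrier n k → D.map (add_zero k) x =
      koszulSign K k • S.kappaDerivative.map (sub_add_cancel k 1) (S.d x)) ∧
      D.map (add_zero (-1)) S.κ = S.generator 1 := by
  obtain ⟨D, hD, hκ⟩ := GrOperad.exists_pointDerivation S.free 0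
    (fun {n k} => koszulSign K k •
      (S.kappaDerivative.map (show k - 1 + 1 = k + 0 by omega)).comp S.d) (by
        simp [S.d_one]) (by
        intro n k σ x _
        simp only [LinearMap.smul_apply, LinearMap.comp_apply, map_smul]
        rw [S.d_act, S.kappaDerivative.map_act]) (by
        intro m n r a b c i hi hr hd x y hx hy
        have hab : koszulSign K c = koszulSign K a * koszulSign K b := by
          rw [← hd, koszulSign_add]
        simp only [LinearMap.smul_apply, LinearMap.comp_apply, map_smul]
        rw [S.d_comp, map_add, map_smul,
          S.kappaDerivative.map_comp i hi hr _ (show a - 1 + 1 = a + 0 by omega) rfl,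
          S.kappaDerivative.map_comp i hi hr _ rfl (show b - 1 + 1 = b + 0 by omega),
          S.kappaDerivative_of_mem rfl hx, S.kappaDerivative_of_mem rfl hy]
        simp only [map_zero, LinearMap.zero_apply, smul_zero, add_zero, zero_add, smul_add,
          smul_smul, hab, one_mul, zero_mul, koszulSign_zero]
        rw [mul_assoc, koszulSign_mul_self, mul_one, mul_right_comm, koszulSign_mul_self, one_mul])
    (S.generator 1)
  -- A free target degree `l` allows passing from degree `k + 0` to degree `k`.
  have hD' : ∀ {n : ℕ} {k l : ℤ} (h : k + 0 = l) (h' : k - 1 + 1 = l) {x : Q.obj n k},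
      x ∈ S.base.carrier n k →
      D.map h x = koszulSign K k • S.kappaDerivative.map h' (S.d x) := by
    rintro n k _ rfl h' x hx
    exact hD hx
  exact ⟨D, fun hx => hD' _ _ hx, hκ⟩

end CurvStructure

/-! ### The canonical morphism and its compatibility with the structures. -/

namespace CurvStructure
variable (S : CurvStructure Q)

/-- The derivation of degree `0` with `generator n ↦ generator (n + 1)` that adds a new first
input. -/
noncomputable def addInput : Q.PointDerivation 0 := S.exists_addInput.choose

theorem addInput_of_mem {n : ℕ} {k : ℤ} {x : Q.obj n k} (hx : x ∈ S.base.carrier n k) :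
    S.addInput.map (add_zero k) x =
      koszulSign K k • S.kappaDerivative.map (sub_add_cancel k 1) (S.d x) :=
  S.exists_addInput.choose_spec.1 hx

theorem addInput_generator : ∀ n, S.addInput.map (add_zero (-1)) (S.generator n) =
    S.generator (n + 1)
  | 0 => S.exists_addInput.choose_spec.2
  | n + 1 => by
    rw [S.addInput_of_mem (S.generator_succ_mem n), S.generator_succ (n + 1), koszulSign_neg,
      koszulSign_one, neg_one_smul]

/-- Apply `addInput` to dν_n = r_n − ν_{n+1} ∘₁ κ. The first term gives r_{n+1} + ν_{n+1} ∘₁ ν_1 by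
the recursion and the second ν_{n+2} ∘₁ κ + ν_{n+1} ∘₁ ν_1; the terms with ν_1 cancel and dν_{n+1}
is left. -/
theorem d_generator_succ (n : ℕ) :
    S.d (S.generator (n + 1)) = S.addInput.map (add_zero (-1 - 1)) (S.d (S.generator n)) := by
  rw [S.d_generator n, map_sub, S.addInput_of_mem (S.remainder_mem n),
    S.addInput.map_comp 0 n.succ_pos _ _ (add_zero (-1)) (add_zero (-1)), S.addInput_generator,
    show S.addInput.map (add_zero (-1)) S.κ = S.generator 1 from S.addInput_generator 0,
    (S.generator_relation n).1, slotCycle_zero, Q.act_one,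
    Q.comp_one_slot (n + 1).succ_pos _ _ _ _ (S.generator_relation n).2, slotCycle_zero, Q.act_one,
    S.d_generator (n + 1), zero_mul, koszulSign_zero, one_smul, koszulSign_sub, koszulSign_neg,
    koszulSign_mul_self, one_smul]
  exact (add_sub_add_right_eq_sub _ _ _).symm

/-- The morphism from the curved `L∞` operad. -/
noncomputable def fromCLInf : (CLInf K).Hom Q := CLInf.lift S.generator S.act_generator

theorem fromCLInf_ell (n : ℕ) : S.fromCLInf.map n (-1) (CLInf.ell K n) = S.generator n := rfl

theorem fromCLInf_addInput {n : ℕ} {k : ℤ} (x : (CLInf K).obj n k) :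
    S.fromCLInf.map (n + 1) k (CLInf.addInput x) =
      S.addInput.map (add_zero k) (S.fromCLInf.map n k x) := by
  induction x using CLInf.induction with
  | ell n => rw [CLInf.addInput_ell, fromCLInf_ell, fromCLInf_ell, addInput_generator]
  | one => rw [CLInf.addInput_one, GrOperad.Hom.map_one, S.addInput.map_one, map_zero]
  | zero => simp
  | add x y hx hy => simp [hx, hy]
  | smul t x hx => simp [hx]
  | act σ x hx =>
    rw [CLInf.addInput_act, GrOperad.Hom.map_act, GrOperad.Hom.map_act, S.addInput.map_act, hx]
  | comp i hi hr hd x y hx hy =>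
    rw [CLInf.addInput_comp, map_add, GrOperad.Hom.map_act, GrOperad.Hom.map_comp,
      GrOperad.Hom.map_comp, GrOperad.Hom.map_comp, hx, hy,
      S.addInput.map_comp i hi hr hd (add_zero _) (add_zero _), zero_mul, koszulSign_zero, one_smul]

/-- On both sides the differential of the next generator is `addInput` of the differential of the
previous one, so only ℓ_0 needs a computation. -/
theorem fromCLInf_diff_ell : ∀ n : ℕ,
    S.fromCLInf.map n (-1 - 1) (CLInf.diff (CLInf.ell K n)) = S.d (S.generator n)
  | 0 => by
    rw [CLInf.diff_ell, CLInf.shuffleSum_zero, map_neg, GrOperad.Hom.map_comp, fromCLInf_ell,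
      fromCLInf_ell, S.d_generator 0, S.remainder_zero, zero_sub]
    rfl
  | n + 1 => by
    rw [← CLInf.addInput_ell, CLInf.diff_addInput, fromCLInf_addInput, fromCLInf_diff_ell n,
      d_generator_succ]

theorem fromCLInf_diff {n : ℕ} {k : ℤ} (x : (CLInf K).obj n k) :
    S.fromCLInf.map n (k - 1) (CLInf.diff x) = S.d (S.fromCLInf.map n k x) := by
  induction x using CLInf.induction with
  | ell n => exact S.fromCLInf_diff_ell n
  | one => rw [CLInf.diff_one, GrOperad.Hom.map_one, S.d_one, map_zero]
  | zero => simp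
  | add x y hx hy => simp [hx, hy]
  | smul t x hx => simp [hx]
  | act σ x hx => rw [CLInf.diff_act, GrOperad.Hom.map_act, GrOperad.Hom.map_act, S.d_act, hx]
  | comp i hi hr hd x y hx hy =>
    rw [CLInf.diff_comp, map_add, map_smul, GrOperad.Hom.map_comp, GrOperad.Hom.map_comp,
      GrOperad.Hom.map_comp, hx, hy, S.d_comp]

theorem fromCLInf_mem_base {n : ℕ} {k : ℤ} {x : (CLInf K).obj n k}
    (hx : x ∈ (CLInf.base K).carrier n k) : S.fromCLInf.map n k x ∈ S.base.carrier n k := by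
  let B : Suboperad (CLInf K) :=
    { carrier := fun n k => (S.base.carrier n k).comap (S.fromCLInf.map n k)
      one_mem := by
        rw [Submodule.mem_comap, GrOperad.Hom.map_one]
        exact S.base.one_mem
      act_mem := fun σ x hx => by
        rw [Submodule.mem_comap, GrOperad.Hom.map_act]
        exact S.base.act_mem σ hx
      comp_mem := fun i hi hr hd x y hx hy => by
        rw [Submodule.mem_comap, GrOperad.Hom.map_comp]
        exact S.base.comp_mem i hi hr hd hx hy }
  refine CLInf.base_le B (fun n hn => ?_) hx
  obtain _ | n := n
  · omega
  · exact S.generator_succ_mem n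

/-- A morphism compatible with the structures sends the generators to the canonical elements. -/
theorem map_ell_eq_generator (f : (CLInf K).Hom Q)
    (hd : ∀ n, f.map n (-1 - 1) (CLInf.diff (CLInf.ell K n)) = S.d (f.map n (-1) (CLInf.ell K n)))
    (hκ : f.map 0 (-1) (CLInf.ell K 0) = S.κ)
    (hbase : ∀ {n : ℕ} {k : ℤ} {x : (CLInf K).obj n k}, x ∈ (CLInf.base K).carrier n k →
      f.map n k x ∈ S.base.carrier n k) (n : ℕ) :
    f.map n (-1) (CLInf.ell K n) = S.generator n := by
  induction n with
  | zero => exact hκ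
  | succ n ih =>
    have hz : CLInf.diff (CLInf.ell K n) + CLInf.curvatureTerm K n ∈
        (CLInf.base K).carrier n (-1 - 1) := by
      obtain rfl | hn := n.eq_zero_or_pos
      · rw [CLInf.diff_ell, CLInf.shuffleSum_zero, CLInf.curvatureTerm, neg_add_cancel]
        exact zero_mem _
      · exact CLInf.diff_ell_add_curvatureTerm_mem_base hn
    -- The image of dℓ_n + ℓ_{n+1} ∘₁ ℓ_0 lies in Q₀, so its derivative in κ vanishes; this
    -- derivative is D d ν_n plus the image of ℓ_{n+1}.
    have h := S.kappaDerivative_of_mem (sub_add_cancel (-1) 1) (hbase hz)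
    rw [map_add, hd, ih, CLInf.curvatureTerm, f.map_comp, hκ, map_add,
      S.kappaDerivative_comp_kappa 0 _ _ _ (hbase (CLInf.ell_mem_base n.succ_pos)), slotCycle_zero,
      Q.act_one, add_eq_zero_iff_neg_eq] at h
    exact h.symm

end CurvStructure

end

end

/-! ### Initiality. -/

namespace CLInf

/-- The curved `L∞` operad is an initial object. -/
noncomputable def isInitial (K : Type u) [Field K] [CharZero K] :
    Limits.IsInitial (CurvSigma.mk (CLInf K) (curvStructure K)) :=
  Limits.IsInitial.ofUniqueHom
    (fun Y =>
      ({ toHom := Y.str.fromCLInf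
         map_d := Y.str.fromCLInf_diff
         map_κ := rfl
         map_base := Y.str.fromCLInf_mem_base } : CurvSigma.Hom _ Y))
    (fun Y (m : CurvSigma.Hom _ Y) => by
      have h : m.toHom = Y.str.fromCLInf := hom_ext fun n =>
        Y.str.map_ell_eq_generator m.toHom (fun n => m.map_d _) m.map_κ m.map_base n
      exact CurvSigma.Hom.ext (congrArg GrOperad.Hom.map h))

end CLInf

theorem theorem1p3 (K : Type u) [Field K] [CharZero K] :
    ∃ S : CurvStructure (CLInf K),
      (∀ n : ℕ, S.d (CLInf.ell K n) = -shuffleSum (CLInf K) (CLInf.ell K) n) ∧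
      S.κ = CLInf.ell K 0 ∧
      S.base = CLInf.base K ∧
      Nonempty (Limits.IsInitial (CurvSigma.mk (CLInf K) S)) :=
  ⟨CLInf.curvStructure K, CLInf.diff_ell, rfl, rfl, ⟨CLInf.isInitial K⟩⟩
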